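/- Let $n\ge 0$, let $M$ be a smooth $(n+1)$-dimensional manifold and $\pi:M\to\mathbb R$ a surjective smooth submersion. Let $\pi_{10}:J^1\pi\to M$ be the first jet bundle of $\pi$, i.e. the affine subbundle $\{d\pi=1\}$ of $TM$, with the coordinates $(t,x^i,y^i)$ induced by fibred coordinates $(t,x^i)$ of $M$. Let $J=\frac{\partial}{\partial y^i}\otimes(dx^i-y^i\,dt)$ be the vertical endomorphism and, on forms, $d_J=i_J\circ d-d\circ i_J$, where $(i_J\omega)(X_1,\dots,X_k)=\sum_i\omega(X_1,\dots,JX_i,\dots,X_k)$. Let $S$ be a semispray: a smooth vector field on $J^1\pi$ with $J(S)=0$ and $dt(S)=1$. Let $W\subseteq J^1\pi$ be open. Denote by $\Lambda^1_S(W)$ the set of smooth $1$-forms $\theta$ on $W$ that are semi-basic (they vanish on $\ker D\pi_{10}$), non-degenerate ($d\theta+i_Sd\theta\wedge dt$ has rank $2n$ at every point of $W$) and satisfy $\mathcal L_Sd\theta=0$. For $L\in C^\infty(W)$ let $\theta_L=L\,dt+d_JL$ be its Poincaré–Cartan form; $L$ is a regular Lagrangian on $W$ if $d\theta_L$ has rank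 $2n$ at every point of $W$, and it is a regular Lagrangian for $S$ if moreover $\mathcal L_S\theta_L=dL$ on $W$. A first integral (conservation law) of $S$ on $W$ is an $f\in C^\infty(W)$ with $S(f)=0$. We say that $S$ is *Lagrangian on $W$* if it has a regular Lagrangian on $W$, and *conservative Lagrangian on $W$* if it has on $W$ a regular Lagrangian and a first integral $f$ with $df\not\equiv0$. We say that $S$ is a *Lagrangian vector field* if every point of $J^1\pi$ has an open neighbourhood on which $S$ is Lagrangian, and a *conservative Lagrangian vector field* if every $u\in J^1\pi$ has an open neighbourhood on which $S$ has a regular Lagrangian and a first integral $f$ such that $df$ does not vanish identically on any neighbourhood of $u$. **(i)** $S$ is a Lagrangian vector field if and only if every point of $J^1\pi$ has an open neighbourhood $W$ such that some $\theta\in\Lambda^1_S(W)$ satisfies $d_J\theta=0$. More precisely, for every open $W\subseteq J^1\pi$ (for instance $W=J^1\pi$), $S$ is Lagrangian on $W$ if and only if there is $\theta\in\Lambda^1_S(W)$ with $d_J\theta=0$. For every such $W$ and $\theta$ there is a regular Lagrangian $L$ on $W$ with $\theta=\theta_L$ and $\mathcal L_S\theta=dL$. **(ii)** $S$ is a conservative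 Lagrangian vector field if and only if every $u\in J^1\pi$ has an open neighbourhood $W$ such that for some $\theta\in\Lambda^1_S(W)$ the form $d_J\theta$ does not vanish identically on any neighbourhood of $u$. More precisely, let $W\subseteq J^1\pi$ be open. If $S$ is conservative Lagrangian on $W$, then there is $\theta\in\Lambda^1_S(W)$ with $d_J\theta\not\equiv0$; and if every closed $1$-form on $W$ is exact, then the converse holds as well. For every $\theta\in\Lambda^1_S(W)$ with $d_J\theta\not\equiv0$, every point of $W$ has an open neighbourhood $W'\subseteq W$ on which $$\theta=\theta_L+f\,dt$$ with a regular Lagrangian $L$ for $S$ on $W'$ and a first integral $f$ of $S$ on $W'$, where $df\not\equiv0$ on $W'$ if $d_J\theta\not\equiv0$ on $W'$; if every closed $1$-form on $W$ is exact, one can take $W'=W$. -/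

import Mathlib

open scoped Manifold ContDiff Topology
open Set Manifold

noncomputable section

section DifferentialForms

variable {E : Type*} [NormedAddCommGroup E] [NormedSpace ℝ E]
  {N : Type*} [TopologicalSpace N] [ChartedSpace E N] {k : ℕ}

variable (E N k) in
/-- Differential `k`-forms (not necessarily smooth) on a manifold `N` modelled on `E`. -/
abbrev DForm : Type _ := ∀ u : N, TangentSpace 𝓘(ℝ, E) u [⋀^Fin k]→L[ℝ] ℝ

variable (E N) in
/-- Vector fields (not necessarily smooth) on `N`. -/
abbrev VField : Type _ := ∀ u : N, TangentSpace 𝓘(ℝ, E) u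

variable (E N) in
/-- Fields of endomorphisms of the tangent spaces, i.e. `(1,1)`-tensor fields. -/
abbrev EndoField : Type _ := ∀ u : N, TangentSpace 𝓘(ℝ, E) u →L[ℝ] TangentSpace 𝓘(ℝ, E) u

namespace DForm

/-- The expression of a form in a chart `c`: its pullback under the inverse of `c`. -/
def inChart (c : OpenPartialHomeomorph N E) (η : DForm E N k) : E → E [⋀^Fin k]→L[ℝ] ℝ :=
  fun z => (η (c.symm z)).compContinuousLinearMap (mfderiv 𝓘(ℝ, E) 𝓘(ℝ, E) c.symm z)

/-- `η` is `C^∞` on the open set `W`: its coefficients are, in every chart of the atlas. -/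
def IsSmoothOn (η : DForm E N k) (W : Set N) : Prop :=
  ∀ c ∈ atlas E N, ContDiffOn ℝ ∞ (η.inChart c) (c.target ∩ c.symm ⁻¹' W)

/-- A function, as a `0`-form. -/
def ofFun (f : N → ℝ) : DForm E N 0 :=
  fun u => ContinuousAlternatingMap.constOfIsEmpty ℝ (TangentSpace 𝓘(ℝ, E) u) (Fin 0) (f u)

/-- The exterior derivative `dη`, computed at `u` in the preferred chart at `u`. -/
def extD (η : DForm E N k) : DForm E N (k + 1) := fun u =>
  (extDeriv (η.inChart (chartAt E u)) (chartAt E u u)).compContinuousLinearMap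
    (mfderiv 𝓘(ℝ, E) 𝓘(ℝ, E) (chartAt E u) u)

/-- The differential `df` of a function. -/
def differential (f : N → ℝ) : DForm E N 1 := extD (ofFun f)

/-- The inner product `i_X η` with a vector field (inserted in the first slot). -/
def interior (X : VField E N) (η : DForm E N (k + 1)) : DForm E N k := fun u =>
  ContinuousAlternatingMap.curryLeft (E := E) (η u) (X u)

/-- The Lie derivative `L_X = d ∘ i_X + i_X ∘ d` on forms of positive degree. -/
def lie (X : VField E N) (η : DForm E N (k + 1)) : DForm E N (k + 1) :=
  extD (interior X η) + interior X (extD η)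

/-- The value `θ(X)` of a `1`-form on a vector. -/
def eval (θ : DForm E N 1) (u : N) (v : TangentSpace 𝓘(ℝ, E) u) : ℝ := θ u (fun _ => v)

/-- For `A` linear: `(v₁, …, v_k) ↦ ∑ i, η (v₁, …, A vᵢ, …, v_k)`. -/
def derivationAux {V : Type*} [AddCommGroup V] [Module ℝ V] [TopologicalSpace V]
    (A : V →L[ℝ] V) (η : V [⋀^Fin k]→L[ℝ] ℝ) : V [⋀^Fin k]→L[ℝ] ℝ where
  toContinuousMultilinearMap := ∑ i, η.toContinuousMultilinearMap.compContinuousLinearMap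
    (fun j => if j = i then A else ContinuousLinearMap.id ℝ V)
  map_eq_zero_of_eq' := by
    intro v i j hij hne
    have hterm : ∀ l : Fin k, (η.toContinuousMultilinearMap.compContinuousLinearMap
        (fun m => if m = l then A else ContinuousLinearMap.id ℝ V)) v
          = η (Function.update v l (A (v l))) := by
      intro l
      refine congrArg η (funext fun m => ?_)
      by_cases hm : m = l
      · subst hm; simp
      · simp [hm]
    change (∑ l, η.toContinuousMultilinearMap.compContinuousLinearMap
      (fun m => if m = l then A else ContinuousLinearMap.id ℝ V)) v = 0
    rw [sum_apply, Finset.sum_congr rfl fun l _ => hterm l,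
      ← Finset.add_sum_erase _ _ (Finset.mem_univ i),
      ← Finset.add_sum_erase _ _ (Finset.mem_erase.2 ⟨hne.symm, Finset.mem_univ j⟩),
      Finset.sum_eq_zero, add_zero]
    · have hswap : Function.update v j (A (v j)) =
          Function.update v i (A (v i)) ∘ Equiv.swap i j := by
        funext m
        by_cases hmi : m = i
        · subst hmi; simp [hne, hne.symm, hij]
        · by_cases hmj : m = j
          · subst hmj; simp [hij]
          · simp [hmi, hmj, Equiv.swap_apply_of_ne_of_ne]
      rw [hswap]
      have h := η.toAlternatingMap.map_swap (Function.update v i (A (v i))) hne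
      exact (congrArg _ h).trans (add_neg_cancel _)
    · intro l hl
      simp only [Finset.mem_erase, Finset.mem_univ, and_true] at hl
      exact η.map_eq_zero_of_eq _ (by simp [hl.1.symm, hl.2.symm, hij]) hne

/-- The formula that `derivationAux` implements. -/
theorem derivationAux_apply {V : Type*} [AddCommGroup V] [Module ℝ V] [TopologicalSpace V]
    (A : V →L[ℝ] V) (η : V [⋀^Fin k]→L[ℝ] ℝ) (v : Fin k → V) :
    derivationAux A η v = ∑ i, η (Function.update v i (A (v i))) := by
  change (∑ l, η.toContinuousMultilinearMap.compContinuousLinearMap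
    (fun m => if m = l then A else ContinuousLinearMap.id ℝ V)) v = _
  rw [sum_apply]
  refine Finset.sum_congr rfl fun l _ => congrArg η (funext fun m => ?_)
  by_cases hm : m = l
  · subst hm; simp
  · simp [hm]

/-- The inner product `i_A η` with a `(1,1)`-tensor field,
`(i_A η)(X₁, …, X_k) = ∑ i, η (X₁, …, A Xᵢ, …, X_k)`; it is `0` on functions. -/
def insertion (A : EndoField E N) (η : DForm E N k) : DForm E N k :=
  fun u => derivationAux (A u) (η u)

/-- The exterior derivative `d_A = i_A ∘ d - d ∘ i_A` with respect to a `(1,1)`-tensor field. -/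
def dEndo (A : EndoField E N) (η : DForm E N k) : DForm E N (k + 1) :=
  insertion A (extD η) - extD (insertion A η)

/-- The wedge product of two covectors. -/
def wedgeAux (a b : E [⋀^Fin 1]→L[ℝ] ℝ) : E [⋀^Fin 2]→L[ℝ] ℝ :=
  ContinuousAlternatingMap.alternatizeUncurryFin
    (((ContinuousAlternatingMap.ofSubsingleton ℝ E ℝ (0 : Fin 1)).symm a).smulRight b)

/-- The formula that `wedgeAux` implements. -/
theorem wedgeAux_apply (a b : E [⋀^Fin 1]→L[ℝ] ℝ) (v : Fin 2 → E) :
    wedgeAux a b v = a (fun _ => v 0) * b (fun _ => v 1) - a (fun _ => v 1) * b (fun _ => v 0) := by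
  unfold wedgeAux
  rw [ContinuousAlternatingMap.alternatizeUncurryFin_apply, Fin.sum_univ_two]
  have h0 : (0 : Fin 2).removeNth v = fun _ => v 1 := by
    funext m; fin_cases m; rfl
  have h1 : (1 : Fin 2).removeNth v = fun _ => v 0 := by
    funext m; fin_cases m; rfl
  have h (x y : E) :
      (((ContinuousAlternatingMap.ofSubsingleton ℝ E ℝ (0 : Fin 1)).symm a).smulRight b) x
        (fun _ => y) = a (fun _ => x) * b (fun _ => y) := rfl
  rw [h0, h1, h, h]
  simp [sub_eq_add_neg]

/-- The wedge product `α ∧ β` of two `1`-forms. -/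
def wedge (α β : DForm E N 1) : DForm E N 2 := fun u => wedgeAux (E := E) (α u) (β u)

/-- The rank of a `2`-form at a point: the rank of the linear map `v ↦ i_v η`. -/
def rankAt (η : DForm E N 2) (u : N) : ℕ :=
  Module.finrank ℝ
    (LinearMap.range (ContinuousAlternatingMap.curryLeft (E := E) (η u)).toLinearMap)

end DForm

/-- Every smooth closed `1`-form on `W` is exact on `W` (the first de Rham cohomology of the
open set `W` vanishes). -/
def ClosedOneFormsExactOn (E : Type*) [NormedAddCommGroup E] [NormedSpace ℝ E]
    {N : Type*} [TopologicalSpace N] [ChartedSpace E N] (W : Set N) : Prop :=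
  ∀ α : DForm E N 1, α.IsSmoothOn W → (∀ u ∈ W, α.extD u = 0) →
    ∃ g : N → ℝ, ContMDiffOn 𝓘(ℝ, E) 𝓘(ℝ, ℝ) ∞ g W ∧ ∀ u ∈ W, α u = DForm.differential g u

end DifferentialForms

section JetBundle

/-- The model `ℝⁿ` of the fibres. -/
abbrev Rn (n : ℕ) : Type := EuclideanSpace ℝ (Fin n)

/-- The model space of the first jet bundle, with coordinates `((t, x), y)`. -/
abbrev JetModel (n : ℕ) : Type := (ℝ × Rn n) × Rn n

/-- The smooth `(n+1)`-dimensional manifold `M` is fibred over `ℝ` by `π`: `π` is a surjective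
smooth submersion. -/
class IsFibredOverReal (n : ℕ) {M : Type*} [TopologicalSpace M]
    [ChartedSpace (EuclideanSpace ℝ (Fin (n + 1))) M] [IsManifold (𝓡 (n + 1)) ∞ M]
    (π : M → ℝ) : Prop where
  submersion : IsSubmersion (𝓡 (n + 1)) 𝓘(ℝ, ℝ) ∞ π
  surjective : Function.Surjective π

/-- Fibred coordinates on `M`: a smooth chart `(t, x)` whose first coordinate is `t = π`. -/
structure FibredChart (n : ℕ) {M : Type*} [TopologicalSpace M]
    [ChartedSpace (EuclideanSpace ℝ (Fin (n + 1))) M] (π : M → ℝ) where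
  chart : OpenPartialHomeomorph M (ℝ × Rn n)
  smooth : ContMDiffOn (𝓡 (n + 1)) 𝓘(ℝ, ℝ × Rn n) ∞ chart chart.source
  smooth_symm : ContMDiffOn 𝓘(ℝ, ℝ × Rn n) (𝓡 (n + 1)) ∞ chart.symm chart.target
  fst_eq : ∀ x ∈ chart.source, (chart x).1 = π x

/-- The differential `dπ` at a point of `M`. -/
def timeDiff (n : ℕ) {M : Type*} [TopologicalSpace M]
    [ChartedSpace (EuclideanSpace ℝ (Fin (n + 1))) M] (π : M → ℝ) (x : M) :
    TangentSpace (𝓡 (n + 1)) x →L[ℝ] ℝ :=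
  mfderiv (𝓡 (n + 1)) 𝓘(ℝ, ℝ) π x

/-- The first jet bundle `J¹π`. The jet `j¹_t γ` of a local section `γ` of `π` is determined by
`γ(t)` and the velocity `γ'(t)`, which ranges over all tangent vectors `v` of `M` with `dπ(v) = 1`;
so `J¹π` is the affine subbundle `dπ = 1` of `TM`. -/
def J1 (n : ℕ) {M : Type*} [TopologicalSpace M]
    [ChartedSpace (EuclideanSpace ℝ (Fin (n + 1))) M] (π : M → ℝ) : Type _ :=
  {u : TangentBundle (𝓡 (n + 1)) M //
    timeDiff n π u.proj u.snd = 1}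

section Charts

variable {n : ℕ} {M : Type*} [TopologicalSpace M]
  [ChartedSpace (EuclideanSpace ℝ (Fin (n + 1))) M] {π : M → ℝ}

namespace J1

/-- The projection `π₁₀ : J¹π → M`. -/
def proj (u : J1 n π) : M := u.1.proj

/-- The velocity of a jet. -/
def velocity (u : J1 n π) : TangentSpace (𝓡 (n + 1)) u.proj := u.1.snd

end J1

namespace FibredChart

variable (e : FibredChart n π)

lemma mdiffAt {x : M} (hx : x ∈ e.chart.source) :
    MDifferentiableAt (𝓡 (n + 1)) 𝓘(ℝ, ℝ × Rn n) e.chart x :=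
  ((e.smooth x hx).contMDiffAt (e.chart.open_source.mem_nhds hx)).mdifferentiableAt (by simp)

lemma mdiffAt_symm {z : ℝ × Rn n} (hz : z ∈ e.chart.target) :
    MDifferentiableAt 𝓘(ℝ, ℝ × Rn n) (𝓡 (n + 1)) e.chart.symm z :=
  ((e.smooth_symm z hz).contMDiffAt (e.chart.open_target.mem_nhds hz)).mdifferentiableAt (by simp)

lemma mfderiv_fst {x : M} (hx : x ∈ e.chart.source) (v : TangentSpace (𝓡 (n + 1)) x) :
    (mfderiv (𝓡 (n + 1)) 𝓘(ℝ, ℝ × Rn n) e.chart x v : ℝ × Rn n).1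
      = timeDiff n π x v := by
  have h1 : π =ᶠ[𝓝 x] (fun p : ℝ × Rn n => p.1) ∘ e.chart := by
    filter_upwards [e.chart.open_source.mem_nhds hx] with y hy
    exact (e.fst_eq y hy).symm
  have h2 : HasMFDerivAt 𝓘(ℝ, ℝ × Rn n) 𝓘(ℝ, ℝ) (fun p : ℝ × Rn n => p.1) (e.chart x)
      (ContinuousLinearMap.fst ℝ ℝ (Rn n)) := hasFDerivAt_fst.hasMFDerivAt
  have h3 := (h2.comp x (e.mdiffAt hx).hasMFDerivAt).congr_of_eventuallyEq h1
  rw [timeDiff, h3.mfderiv]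
  rfl

lemma mfderiv_symm_mfderiv {x : M} (hx : x ∈ e.chart.source) (v : TangentSpace (𝓡 (n + 1)) x) :
    mfderiv 𝓘(ℝ, ℝ × Rn n) (𝓡 (n + 1)) e.chart.symm (e.chart x)
      (mfderiv (𝓡 (n + 1)) 𝓘(ℝ, ℝ × Rn n) e.chart x v) = v := by
  have h := HasMFDerivAt.comp x (e.mdiffAt_symm (e.chart.map_source hx)).hasMFDerivAt
    (e.mdiffAt hx).hasMFDerivAt
  have h1 : e.chart.symm ∘ e.chart =ᶠ[𝓝 x] id := by
    filter_upwards [e.chart.open_source.mem_nhds hx] with y hy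
    exact e.chart.left_inv hy
  have h2 := hasMFDerivAt_unique (h.congr_of_eventuallyEq h1.symm) (hasMFDerivAt_id x)
  exact congrArg (fun f => f v) h2

lemma mfderiv_mfderiv_symm {z : ℝ × Rn n} (hz : z ∈ e.chart.target) (w : ℝ × Rn n) :
    mfderiv (𝓡 (n + 1)) 𝓘(ℝ, ℝ × Rn n) e.chart (e.chart.symm z)
      (mfderiv 𝓘(ℝ, ℝ × Rn n) (𝓡 (n + 1)) e.chart.symm z w) = w := by
  have h := HasMFDerivAt.comp z (e.mdiffAt (e.chart.map_target hz)).hasMFDerivAt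
    (e.mdiffAt_symm hz).hasMFDerivAt
  have h1 : e.chart ∘ e.chart.symm =ᶠ[𝓝 z] id := by
    filter_upwards [e.chart.open_target.mem_nhds hz] with y hy
    exact e.chart.right_inv hy
  have h2 := hasMFDerivAt_unique (h.congr_of_eventuallyEq h1.symm) (hasMFDerivAt_id z)
  exact congrArg (fun f => f w) h2

lemma mfderiv_symm_one {z : ℝ × Rn n} (hz : z ∈ e.chart.target) (y : Rn n) :
    timeDiff n π (e.chart.symm z)
      (mfderiv 𝓘(ℝ, ℝ × Rn n) (𝓡 (n + 1)) e.chart.symm z ((1, y) : ℝ × Rn n)) = 1 := by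
  have h := e.mfderiv_fst (e.chart.map_target hz)
    (mfderiv 𝓘(ℝ, ℝ × Rn n) (𝓡 (n + 1)) e.chart.symm z ((1, y) : ℝ × Rn n))
  rw [e.mfderiv_mfderiv_symm hz] at h
  exact h.symm

/-- The jet with coordinates `p = ((t, x), y)`: the velocity is `∂/∂t + yⁱ ∂/∂xⁱ`. -/
def jetOfCoord (p : JetModel n) (hp : p.1 ∈ e.chart.target) : J1 n π :=
  ⟨⟨e.chart.symm p.1, mfderiv 𝓘(ℝ, ℝ × Rn n) (𝓡 (n + 1)) e.chart.symm p.1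
    ((1, p.2) : ℝ × Rn n)⟩, e.mfderiv_symm_one hp p.2⟩

open Classical in
/-- `jetOfCoord`, extended by the junk value `u₀` outside the range of the chart. -/
def jetInv (u₀ : J1 n π) (p : JetModel n) : J1 n π :=
  if hp : p.1 ∈ e.chart.target then e.jetOfCoord p hp else u₀

lemma jetInv_of_mem (u₀ : J1 n π) {p : JetModel n} (hp : p.1 ∈ e.chart.target) :
    e.jetInv u₀ p = e.jetOfCoord p hp := dif_pos hp

end FibredChart

variable [IsManifold (𝓡 (n + 1)) ∞ M]

/-- `J¹π` carries the topology of a subspace of `TM`. -/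
instance J1.instTopologicalSpace (π : M → ℝ) : TopologicalSpace (J1 n π) :=
  inferInstanceAs (TopologicalSpace {u : TangentBundle (𝓡 (n + 1)) M //
    timeDiff n π u.proj u.snd = 1})

/-- The chart `(t, x, y)` of `J¹π` induced by the fibred chart `(t, x)` of `M`. -/
def FibredChart.jetChart (e : FibredChart n π) (u₀ : J1 n π) : OpenPartialHomeomorph (J1 n π) (JetModel n) where
  toFun u := (e.chart u.proj,
    (mfderiv (𝓡 (n + 1)) 𝓘(ℝ, ℝ × Rn n) e.chart u.proj u.velocity : ℝ × Rn n).2)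
  invFun := e.jetInv u₀
  source := {u | u.proj ∈ e.chart.source}
  target := {p | p.1 ∈ e.chart.target}
  map_source' u hu := e.chart.map_source hu
  map_target' p hp := by
    have hp' : p.1 ∈ e.chart.target := hp
    rw [e.jetInv_of_mem u₀ hp']
    exact e.chart.map_target hp'
  left_inv' u hu := by
    obtain ⟨⟨x, v⟩, huv⟩ := u
    have hx : x ∈ e.chart.source := hu
    have hp' : e.chart x ∈ e.chart.target := e.chart.map_source hx
    have h1 : ((1, (mfderiv (𝓡 (n + 1)) 𝓘(ℝ, ℝ × Rn n) e.chart x v : ℝ × Rn n).2) : ℝ × Rn n)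
        = (mfderiv (𝓡 (n + 1)) 𝓘(ℝ, ℝ × Rn n) e.chart x v : ℝ × Rn n) :=
      Prod.ext ((e.mfderiv_fst hx v).trans huv).symm rfl
    refine (e.jetInv_of_mem u₀ (p := (e.chart x, _)) hp').trans (Subtype.ext ?_)
    change (⟨e.chart.symm (e.chart x), mfderiv 𝓘(ℝ, ℝ × Rn n) (𝓡 (n + 1)) e.chart.symm (e.chart x)
      ((1, (mfderiv (𝓡 (n + 1)) 𝓘(ℝ, ℝ × Rn n) e.chart x v : ℝ × Rn n).2) : ℝ × Rn n)⟩ :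
        TangentBundle (𝓡 (n + 1)) M) = ⟨x, v⟩
    rw [h1]
    have h2 := e.mfderiv_symm_mfderiv hx v
    refine Bundle.TotalSpace.ext (e.chart.left_inv hx) (heq_of_eq h2)
  right_inv' p hp := by
    have hp' : p.1 ∈ e.chart.target := hp
    rw [e.jetInv_of_mem u₀ hp']
    refine Prod.ext (e.chart.right_inv hp') ?_
    have h := congrArg Prod.snd (e.mfderiv_mfderiv_symm hp' ((1, p.2) : ℝ × Rn n))
    exact h
  open_source := by
    have : Continuous (fun u : J1 n π => u.proj) :=
      (FiberBundle.continuous_proj _ (TangentSpace (𝓡 (n + 1)))).comp continuous_subtype_val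
    exact e.chart.open_source.preimage this
  open_target := e.chart.open_target.preimage continuous_fst
  continuousOn_toFun := by
    have h := e.smooth.continuousOn_tangentMapWithin (by simp) e.chart.open_source.uniqueMDiffOn
    have h2 : ContinuousOn (fun u : J1 n π => tangentBundleModelSpaceHomeomorph 𝓘(ℝ, ℝ × Rn n)
        (tangentMapWithin (𝓡 (n + 1)) 𝓘(ℝ, ℝ × Rn n) e.chart e.chart.source u.1))
        {u | u.proj ∈ e.chart.source} :=
      (tangentBundleModelSpaceHomeomorph 𝓘(ℝ, ℝ × Rn n)).continuous.comp_continuousOn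
        (h.comp continuous_subtype_val.continuousOn (fun u hu => hu))
    have h3 : ContinuousOn (fun u : J1 n π => ((e.chart u.proj,
        (mfderiv (𝓡 (n + 1)) 𝓘(ℝ, ℝ × Rn n) e.chart u.proj u.velocity : ℝ × Rn n)) :
          (ℝ × Rn n) × (ℝ × Rn n))) {u | u.proj ∈ e.chart.source} := by
      refine ContinuousOn.congr h2 ?_
      intro u hu
      have hu' : u.1.proj ∈ e.chart.source := hu
      have := mfderivWithin_of_isOpen (I := 𝓡 (n + 1)) (I' := 𝓘(ℝ, ℝ × Rn n)) (f := e.chart)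
        e.chart.open_source hu'
      simp only [tangentMapWithin, this]
      rfl
    exact h3.fst.prodMk h3.snd.snd
  continuousOn_invFun := by
    refine (Topology.IsInducing.subtypeVal.continuousOn_iff).2 ?_
    have h := e.smooth_symm.continuousOn_tangentMapWithin (by simp)
      e.chart.open_target.uniqueMDiffOn
    have h2 : ContinuousOn (fun p : JetModel n => 
        (tangentMapWithin 𝓘(ℝ, ℝ × Rn n) (𝓡 (n + 1)) e.chart.symm e.chart.target
        ((tangentBundleModelSpaceHomeomorph 𝓘(ℝ, ℝ × Rn n)).symm (p.1, ((1, p.2) : ℝ × Rn n)))))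
        {p | p.1 ∈ e.chart.target} := by
      refine h.comp (t := _ ) ?_ (fun u hu => hu)
      refine ((tangentBundleModelSpaceHomeomorph 𝓘(ℝ, ℝ × Rn n)).symm.continuous.comp ?_).continuousOn
      exact (continuous_fst.prodMk (continuous_const.prodMk continuous_snd))
    refine h2.congr ?_
    intro p hp
    have hp' : p.1 ∈ e.chart.target := hp
    have := mfderivWithin_of_isOpen (I' := 𝓡 (n + 1)) (I := 𝓘(ℝ, ℝ × Rn n)) (f := e.chart.symm)
        e.chart.open_target hp'
    refine (congrArg Subtype.val (e.jetInv_of_mem u₀ hp')).trans ?_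
    refine Bundle.TotalSpace.ext rfl (heq_of_eq ?_)
    change _ = mfderivWithin 𝓘(ℝ, ℝ × Rn n) (𝓡 (n + 1)) e.chart.symm e.chart.target p.1 _
    rw [this]
    rfl

/-- Fibred charts exist around every point. -/
theorem exists_fibredChart (π : M → ℝ) [hπ : IsFibredOverReal n π] (x : M) :
    ∃ e : FibredChart n π, x ∈ e.chart.source := by
  obtain ⟨F, _, _, hF⟩ := hπ.submersion
  have h := hF x
  have hfin : FiniteDimensional ℝ (ℝ × F) := h.equiv.toLinearEquiv.finiteDimensional
  have hfinF : FiniteDimensional ℝ F := 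
    Module.Finite.of_surjective (LinearMap.snd ℝ ℝ F) LinearMap.snd_surjective
  have hrank : Module.finrank ℝ F = Module.finrank ℝ (Rn n) := by
    have := h.equiv.toLinearEquiv.finrank_eq
    rw [Module.finrank_prod] at this
    simp at this
    simp
    omega
  let L : F ≃L[ℝ] Rn n := ContinuousLinearEquiv.ofFinrankEq hrank
  let A : EuclideanSpace ℝ (Fin (n + 1)) ≃L[ℝ] ℝ × Rn n :=
    h.equiv.trans ((ContinuousLinearEquiv.refl ℝ ℝ).prodCongr L)
  let c : OpenPartialHomeomorph (ℝ × Rn n) (ℝ × Rn n) :=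
    h.codChart.symm.prod (OpenPartialHomeomorph.refl (Rn n))
  let e : OpenPartialHomeomorph M (ℝ × Rn n) :=
    (h.domChart.trans A.toHomeomorph.toOpenPartialHomeomorph).trans c
  have hsrc : ∀ y ∈ h.domChart.source, (A (h.domChart y)).1 = h.codChart (π y) := by
    intro y hy
    have := h.writtenInCharts (show h.domChart y ∈ (h.domChart.extend (𝓡 (n + 1))).target by
      simp [hy])
    simp [hy] at this
    simp [A, this]
  have hsource : e.source = h.domChart.source := by
    ext y
    simp only [e, c, OpenPartialHomeomorph.trans_source]
    simp
    intro hy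
    rw [hsrc y hy]
    exact h.codChart.map_source (h.source_subset_preimage_source hy)
  have hdc : ContMDiffOn 𝓘(ℝ, ℝ) 𝓘(ℝ, ℝ) ∞ h.codChart.symm h.codChart.target := 
    contMDiffOn_symm_of_mem_maximalAtlas h.codChart_mem_maximalAtlas
  have hdc' : ContMDiffOn 𝓘(ℝ, ℝ) 𝓘(ℝ, ℝ) ∞ h.codChart h.codChart.source := 
    contMDiffOn_of_mem_maximalAtlas h.codChart_mem_maximalAtlas
  have hd : ContMDiffOn (𝓡 (n + 1)) (𝓡 (n + 1)) ∞ h.domChart h.domChart.source := 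
    contMDiffOn_of_mem_maximalAtlas h.domChart_mem_maximalAtlas
  have hd' : ContMDiffOn (𝓡 (n + 1)) (𝓡 (n + 1)) ∞ h.domChart.symm h.domChart.target := 
    contMDiffOn_symm_of_mem_maximalAtlas h.domChart_mem_maximalAtlas
  have hc : ContMDiffOn 𝓘(ℝ, ℝ × Rn n) 𝓘(ℝ, ℝ × Rn n) ∞ c c.source := by
    rw [contMDiffOn_iff_contDiffOn] at *
    have h1 : ContDiffOn ℝ ∞ (fun p : ℝ × Rn n => (h.codChart.symm p.1, p.2)) c.source :=
      (hdc.comp contDiffOn_fst (fun p hp => hp.1)).prodMk contDiffOn_snd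
    exact h1
  have hc' : ContMDiffOn 𝓘(ℝ, ℝ × Rn n) 𝓘(ℝ, ℝ × Rn n) ∞ c.symm c.target := by
    rw [contMDiffOn_iff_contDiffOn] at *
    have h1 : ContDiffOn ℝ ∞ (fun p : ℝ × Rn n => (h.codChart p.1, p.2)) c.target :=
      (hdc'.comp contDiffOn_fst (fun p hp => hp.1)).prodMk contDiffOn_snd
    exact h1
  refine ⟨⟨e, ?_, ?_, ?_⟩, ?_⟩
  · have hA := A.contDiff.contMDiff (n := ∞)
    refine hc.comp (t := c.source) ((hA.comp_contMDiffOn hd).mono hsource.le) ?_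
    intro y hy
    exact hy.2
  · have hA := A.symm.contDiff.contMDiff (n := ∞)
    refine hd'.comp (t := h.domChart.target) (hA.comp_contMDiffOn (hc'.mono ?_)) ?_
    · intro y hy
      exact hy.1
    · intro y hy
      have := hy.2
      simpa using this
  · intro y hy
    have hy' := hsource ▸ hy
    change h.codChart.symm (A (h.domChart y)).1 = _
    rw [hsrc y hy']
    exact h.codChart.left_inv (h.source_subset_preimage_source hy')
  · rw [hsource]; exact h.mem_domChart_source

variable [IsFibredOverReal n π]

/-- `J¹π` is a manifold, with the charts induced by the fibred charts of `M`. -/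
instance J1.instChartedSpace : ChartedSpace (JetModel n) (J1 n π) where
  atlas := {c | ∃ (e : FibredChart n π) (u₀ : J1 n π), c = e.jetChart u₀}
  chartAt u := (exists_fibredChart π u.proj).choose.jetChart u
  mem_chart_source u := (exists_fibredChart π u.proj).choose_spec
  chart_mem_atlas u := ⟨_, u, rfl⟩

/-- `J¹π` is a smooth manifold. -/
instance J1.instIsManifold : IsManifold 𝓘(ℝ, JetModel n) ∞ (J1 n π) := by
  apply isManifold_of_contDiffOn
  rintro _ _ ⟨e, u, rfl⟩ ⟨e', u', rfl⟩
  simp only [modelWithCornersSelf_coe, modelWithCornersSelf_coe_symm, Function.id_comp, 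
    Function.comp_id, Set.range_id, Set.inter_univ, Set.preimage_id]
  set s : Set (ℝ × Rn n) := e.chart.target ∩ e.chart.symm ⁻¹' e'.chart.source with hs
  have hso : IsOpen s := e.chart.symm.isOpen_inter_preimage e'.chart.open_source
  have hsm : ContDiffOn ℝ ∞ (e'.chart ∘ e.chart.symm) s := by
    rw [← contMDiffOn_iff_contDiffOn]
    exact e'.smooth.comp (e.smooth_symm.mono inter_subset_left) (fun z hz => hz.2)
  have hfd : ContDiffOn ℝ ∞ (fun p : JetModel n => 
      ((e'.chart (e.chart.symm p.1)), 
        (fderiv ℝ (e'.chart ∘ e.chart.symm) p.1 ((1, p.2) : ℝ × Rn n)).2)) {p | p.1 ∈ s} := by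
    have h1 : ContDiffOn ℝ ∞ (fderiv ℝ (e'.chart ∘ e.chart.symm)) s :=
      hsm.fderiv_of_isOpen hso (by simp)
    have h2 : ContDiffOn ℝ ∞ (fun p : JetModel n => fderiv ℝ (e'.chart ∘ e.chart.symm) p.1) 
      {p | p.1 ∈ s} := h1.comp contDiffOn_fst (fun p hp => hp)
    have h3 : ContDiffOn ℝ ∞ (fun p : JetModel n => e'.chart (e.chart.symm p.1))
      {p | p.1 ∈ s} := hsm.comp contDiffOn_fst (fun p hp => hp)
    exact h3.prodMk (h2.clm_apply (contDiffOn_const.prodMk contDiffOn_snd)).snd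
  have hsub : ∀ p ∈ ((e.jetChart u).symm.trans (e'.jetChart u')).source, p.1 ∈ s := by
    intro p hp
    have hp1 : p.1 ∈ e.chart.target := hp.1
    have hp2 : ((e.jetChart u).symm p).proj ∈ e'.chart.source := hp.2
    refine ⟨hp1, ?_⟩
    have : ((e.jetChart u).symm p).proj = e.chart.symm p.1 := by
      exact congrArg J1.proj (e.jetInv_of_mem u hp1)
    rw [this] at hp2
    exact hp2
  refine (hfd.mono hsub).congr ?_
  intro p hp
  obtain ⟨hp1, hp2⟩ := hsub p hp
  have h1 : (e.jetChart u).symm p = e.jetOfCoord p hp1 := e.jetInv_of_mem u hp1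
  have h2 : fderiv ℝ (e'.chart ∘ e.chart.symm) p.1 = 
      (mfderiv (𝓡 (n + 1)) 𝓘(ℝ, ℝ × Rn n) e'.chart (e.chart.symm p.1)).comp 
        (mfderiv 𝓘(ℝ, ℝ × Rn n) (𝓡 (n + 1)) e.chart.symm p.1) := by
    rw [← mfderiv_eq_fderiv]
    exact mfderiv_comp p.1 (e'.mdiffAt hp2) (e.mdiffAt_symm hp1)
  simp only [OpenPartialHomeomorph.coe_trans, Function.comp_apply, h1, h2]
  rfl

end Charts

end JetBundle

section Mechanics

variable {n : ℕ} {M : Type*} [TopologicalSpace M]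
  [ChartedSpace (EuclideanSpace ℝ (Fin (n + 1))) M] [IsManifold (𝓡 (n + 1)) ∞ M]
  {π : M → ℝ} [IsFibredOverReal n π]

/-- The `1`-form `dt` on `J¹π`, the differential of `π ∘ π₁₀`. -/
def dtForm (n : ℕ) {M : Type*} [TopologicalSpace M]
    [ChartedSpace (EuclideanSpace ℝ (Fin (n + 1))) M] [IsManifold (𝓡 (n + 1)) ∞ M]
    (π : M → ℝ) [IsFibredOverReal n π] : DForm (JetModel n) (J1 n π) 1 :=
  DForm.differential fun u => π u.proj

/-- The matrix of `∂/∂yⁱ ⊗ (dxⁱ - yⁱ dt)` in the coordinates `((t, x), y)`, i.e. the map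
`((τ, ξ), ζ) ↦ ((0, 0), ξ - τ y)`. -/
def verticalEndoCoord {n : ℕ} (y : Rn n) : JetModel n →L[ℝ] JetModel n :=
  (ContinuousLinearMap.inr ℝ (ℝ × Rn n) (Rn n)).comp
    ((ContinuousLinearMap.snd ℝ ℝ (Rn n) - (ContinuousLinearMap.fst ℝ ℝ (Rn n)).smulRight y).comp
      (ContinuousLinearMap.fst ℝ (ℝ × Rn n) (Rn n)))

/-- The vertical endomorphism `J = ∂/∂yⁱ ⊗ (dxⁱ - yⁱ dt)`. -/
def verticalEndo (n : ℕ) {M : Type*} [TopologicalSpace M]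
    [ChartedSpace (EuclideanSpace ℝ (Fin (n + 1))) M] [IsManifold (𝓡 (n + 1)) ∞ M]
    (π : M → ℝ) [IsFibredOverReal n π] : EndoField (JetModel n) (J1 n π) := fun u =>
  (mfderiv 𝓘(ℝ, JetModel n) 𝓘(ℝ, JetModel n) (chartAt (JetModel n) u).symm
      (chartAt (JetModel n) u u)).comp
    ((verticalEndoCoord (chartAt (JetModel n) u u).2).comp
      (mfderiv 𝓘(ℝ, JetModel n) 𝓘(ℝ, JetModel n) (chartAt (JetModel n) u) u))

/-- The derivation `d_J` defined by the vertical endomorphism. -/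
def dJ {k : ℕ} (η : DForm (JetModel n) (J1 n π) k) : DForm (JetModel n) (J1 n π) (k + 1) :=
  DForm.dEndo (verticalEndo n π) η

/-- A semispray: a smooth vector field `S` on `J¹π` with `J(S) = 0` and `dt(S) = 1`. -/
structure IsSemispray (S : VField (JetModel n) (J1 n π)) : Prop where
  smooth : ContMDiff 𝓘(ℝ, JetModel n) 𝓘(ℝ, JetModel n).tangent ∞
    (fun u => (⟨u, S u⟩ : TangentBundle 𝓘(ℝ, JetModel n) (J1 n π)))
  vertical : ∀ u, verticalEndo n π u (S u) = 0
  time : ∀ u, (dtForm n π).eval u (S u) = 1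

/-- A `1`-form is semi-basic on `W` if it vanishes on the vertical vectors, those in the kernel
of the differential of `π₁₀`. -/
def IsSemibasicOn (θ : DForm (JetModel n) (J1 n π) 1) (W : Set (J1 n π)) : Prop :=
  ∀ u ∈ W, ∀ v : TangentSpace 𝓘(ℝ, JetModel n) u,
    mfderiv 𝓘(ℝ, JetModel n) (𝓡 (n + 1)) (J1.proj : J1 n π → M) u v = 0 → θ.eval u v = 0

/-- `θ` is non-degenerate on `W`: the `2`-form `dθ + i_S dθ ∧ dt` has rank `2n` there. -/
def IsNondegenerateOn (S : VField (JetModel n) (J1 n π)) (θ : DForm (JetModel n) (J1 n π) 1)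
    (W : Set (J1 n π)) : Prop :=
  ∀ u ∈ W, (θ.extD + (DForm.interior S θ.extD).wedge (dtForm n π)).rankAt u = 2 * n

/-- The set `Λ¹_S(W)` of the smooth, semi-basic, non-degenerate `1`-forms `θ` on the open set `W`
with `L_S dθ = 0`. -/
def LambdaS (S : VField (JetModel n) (J1 n π)) (W : Set (J1 n π)) :
    Set (DForm (JetModel n) (J1 n π) 1) :=
  {θ | θ.IsSmoothOn W ∧ IsSemibasicOn θ W ∧ IsNondegenerateOn S θ W ∧
    ∀ u ∈ W, DForm.lie S θ.extD u = 0}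

/-- The form `f dt`. -/
def smulDt (f : J1 n π → ℝ) : DForm (JetModel n) (J1 n π) 1 := fun u => f u • dtForm n π u

/-- The Poincaré-Cartan `1`-form `θ_L = L dt + d_J L`. -/
def poincareCartan (L : J1 n π → ℝ) : DForm (JetModel n) (J1 n π) 1 :=
  smulDt L + dJ (DForm.ofFun L)

/-- `L` is a regular Lagrangian on the open set `W`: it is smooth and `dθ_L` has rank `2n`. -/
def IsRegularLagrangianOn (L : J1 n π → ℝ) (W : Set (J1 n π)) : Prop :=
  ContMDiffOn 𝓘(ℝ, JetModel n) 𝓘(ℝ, ℝ) ∞ L W ∧ ∀ u ∈ W, (poincareCartan L).extD.rankAt u = 2 * n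

/-- `L` is, on `W`, a regular Lagrangian for `S`: moreover `L_S θ_L = dL`. -/
def IsLagrangianFor (S : VField (JetModel n) (J1 n π)) (L : J1 n π → ℝ) (W : Set (J1 n π)) :
    Prop :=
  IsRegularLagrangianOn L W ∧
    ∀ u ∈ W, DForm.lie S (poincareCartan L) u = DForm.differential L u

/-- `f` is a first integral (conservation law) of `S` on the open set `W`: `S(f) = 0`. -/
def IsFirstIntegralOn (S : VField (JetModel n) (J1 n π)) (f : J1 n π → ℝ) (W : Set (J1 n π)) :
    Prop :=
  ContMDiffOn 𝓘(ℝ, JetModel n) 𝓘(ℝ, ℝ) ∞ f W ∧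
    ∀ u ∈ W, (DForm.differential f).eval u (S u) = 0

/-- `S` has a regular Lagrangian that is defined on the whole open set `W`. -/
def IsLagrangianOn (S : VField (JetModel n) (J1 n π)) (W : Set (J1 n π)) : Prop :=
  ∃ L, IsLagrangianFor S L W

/-- `S` is a Lagrangian vector field: around every point it has a locally defined regular
Lagrangian. -/
def IsLagrangian (S : VField (JetModel n) (J1 n π)) : Prop :=
  ∀ u, ∃ W, IsOpen W ∧ u ∈ W ∧ IsLagrangianOn S W

/-- `S` has, on the whole open set `W`, a regular Lagrangian and a first integral that is not
locally constant. -/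
def IsConservativeLagrangianOn (S : VField (JetModel n) (J1 n π)) (W : Set (J1 n π)) : Prop :=
  ∃ L f, IsLagrangianFor S L W ∧ IsFirstIntegralOn S f W ∧
    ∃ u ∈ W, (DForm.differential f : DForm (JetModel n) (J1 n π) 1) u ≠ 0

/-- `S` is a conservative Lagrangian vector field: around every point `u` it has a locally defined
regular Lagrangian and a locally defined first integral that is non-constant near `u`. -/
def IsConservativeLagrangian (S : VField (JetModel n) (J1 n π)) : Prop :=
  ∀ u, ∃ W, IsOpen W ∧ u ∈ W ∧ ∃ L f, IsLagrangianFor S L W ∧ IsFirstIntegralOn S f W ∧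
    ∃ᶠ v in 𝓝 u, (DForm.differential f : DForm (JetModel n) (J1 n π) 1) v ≠ 0

/-- On `W` one has `θ = θ_L + f dt` with a regular Lagrangian `L` for `S` and a first integral
`f` of `S`, and `f` is not locally constant if `d_J θ` does not vanish identically. -/
def HasLagrangianDecompositionOn (S : VField (JetModel n) (J1 n π))
    (θ : DForm (JetModel n) (J1 n π) 1) (W : Set (J1 n π)) : Prop :=
  ∃ L f, IsLagrangianFor S L W ∧ IsFirstIntegralOn S f W ∧
    (∀ u ∈ W, θ u = (poincareCartan L + smulDt f : DForm (JetModel n) (J1 n π) 1) u) ∧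
    ((∃ u ∈ W, dJ θ u ≠ 0) →
      ∃ u ∈ W, (DForm.differential f : DForm (JetModel n) (J1 n π) 1) u ≠ 0)

end Mechanics

end

/-!
For `θ ∈ Λ¹_S(W)` the form `i_S dθ` is closed, because `L_S dθ = d i_S dθ`. Where it has a
potential, say `i_S dθ = -df`, the function `f` is a first integral of `S`. In an adapted chart,
semi-basicity of `θ` gives `L_Sθ ∘ J = θ - θ(S) dt`; since also `L_Sθ ∘ J = d(θ(S) - f) ∘ J`, this
says that `θ = θ_L + f dt` with `L = θ(S) - f`. Moreover `dθ + i_S dθ ∧ dt = dθ_L`, so that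
non-degeneracy of `θ` is regularity of `L`, and contracting with `S` shows that `L` is a Lagrangian
for `S`. Conversely, for a Lagrangian `L` for `S` and a first integral `f`, the form `θ_L + f dt`
lies in `Λ¹_S(W)` and has `f` as a potential.

Finally `d_J θ = 0` if and only if `df = 0`. If `i_S dθ = 0`, then `θ = θ_L` and `d_J θ_L = 0`. If
`d_J θ = 0`, then `α = i_S dθ` is semi-basic, closed and annihilates `S`, and so vanishes by the
formula above, applied to `α` in place of `θ`.
-/

section ChartCalculus

variable {E : Type*} [NormedAddCommGroup E] [NormedSpace ℝ E]
  {N : Type*} [TopologicalSpace N] [ChartedSpace E N] {k : ℕ}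
  {c : OpenPartialHomeomorph N E} {z : E} {W : Set N} {u : N}

/-- The coordinate expression of a vector field in the chart `c`; it is meaningful on `c.target`
only. -/
noncomputable def VField.inChart (c : OpenPartialHomeomorph N E) (X : VField E N) : E → E :=
  fun z => mfderiv 𝓘(ℝ, E) 𝓘(ℝ, E) c (c.symm z) (X (c.symm z))

lemma exists_mem_atlas_symm_eq (E : Type*) [NormedAddCommGroup E] [ChartedSpace E N] (u : N) :
    ∃ c ∈ atlas E N, ∃ z ∈ c.target, c.symm z = u :=
  ⟨chartAt E u, chart_mem_atlas E u, _, mem_chart_target E u,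
    (chartAt E u).left_inv (mem_chart_source E u)⟩

lemma minSmoothness_two_le_infty : minSmoothness ℝ 2 ≤ (∞ : WithTop ℕ∞) := by
  rw [minSmoothness_of_isRCLikeNormedField]
  exact WithTop.coe_le_coe.2 le_top

lemma extDeriv_one_apply (α : E → E [⋀^Fin 1]→L[ℝ] ℝ) (z v w : E) :
    extDeriv α z ![v, w] = fderiv ℝ α z v (fun _ => w) - fderiv ℝ α z w (fun _ => v) := by
  have h₀ : (0 : Fin 2).removeNth ![v, w] = fun _ => w := by
    funext i; fin_cases i; rfl
  have h₁ : (1 : Fin 2).removeNth ![v, w] = fun _ => v := by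
    funext i; fin_cases i; rfl
  rw [extDeriv, ContinuousAlternatingMap.alternatizeUncurryFin_apply, Fin.sum_univ_two, h₀, h₁]
  simp [sub_eq_add_neg]

lemma alternating_two_ext {V : Type*} [AddCommGroup V] [Module ℝ V] [TopologicalSpace V]
    {η η' : V [⋀^Fin 2]→L[ℝ] ℝ} (h : ∀ v w, η ![v, w] = η' ![v, w]) : η = η' := by
  ext v
  rw [show v = ![v 0, v 1] from funext fun i => by fin_cases i <;> rfl]
  exact h (v 0) (v 1)

/-- Covectors as alternating `1`-forms, through which forms are differentiated by the calculus of
continuous linear maps. -/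
noncomputable def covectorEquiv (E : Type*) [NormedAddCommGroup E] [NormedSpace ℝ E] :
    (E →L[ℝ] ℝ) ≃L[ℝ] (E [⋀^Fin 1]→L[ℝ] ℝ) :=
  (ContinuousAlternatingMap.ofSubsingletonLIE (𝕜 := ℝ) (E := E) (F := ℝ)
    (0 : Fin 1)).toContinuousLinearEquiv

lemma fderiv_alternating_one_apply {α : E → E [⋀^Fin 1]→L[ℝ] ℝ} {s : E → E}
    (hα : DifferentiableAt ℝ α z) (hs : DifferentiableAt ℝ s z) (x : E) :
    fderiv ℝ (fun w => α w fun _ => s w) z x =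
      fderiv ℝ α z x (fun _ => s z) + α z fun _ => fderiv ℝ s z x := by
  have h := ((covectorEquiv E).symm.hasFDerivAt.comp z hα.hasFDerivAt).clm_apply hs.hasFDerivAt
  exact (DFunLike.congr_fun h.fderiv x).trans (add_comm _ _)

lemma fderiv_alternating_one_const_apply {α : E → E [⋀^Fin 1]→L[ℝ] ℝ}
    (hα : DifferentiableAt ℝ α z) (v x : E) :
    fderiv ℝ (fun w => α w fun _ => v) z x = fderiv ℝ α z x fun _ => v := by
  rw [fderiv_alternating_one_apply hα (differentiableAt_const v), fderiv_fun_const]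
  exact add_eq_left.2 (α z).map_zero

section Transition

variable [IsManifold 𝓘(ℝ, E) ∞ N]

lemma mdifferentiable_of_mem_atlas_infty (hc : c ∈ atlas E N) :
    c.MDifferentiable 𝓘(ℝ, E) 𝓘(ℝ, E) :=
  haveI : IsManifold 𝓘(ℝ, E) 1 N := IsManifold.of_le (n := ∞) (by simp)
  mdifferentiable_of_mem_atlas hc

lemma mfderiv_mfderiv_symm_of_mem_atlas (hc : c ∈ atlas E N) (hz : z ∈ c.target) (v : E) :
    mfderiv 𝓘(ℝ, E) 𝓘(ℝ, E) c (c.symm z) (mfderiv 𝓘(ℝ, E) 𝓘(ℝ, E) c.symm z v) = v :=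
  DFunLike.congr_fun ((mdifferentiable_of_mem_atlas_infty hc).comp_symm_deriv hz) v

lemma mfderiv_symm_mfderiv_of_mem_atlas (hc : c ∈ atlas E N) (hz : z ∈ c.target)
    (v : TangentSpace 𝓘(ℝ, E) (c.symm z)) :
    mfderiv 𝓘(ℝ, E) 𝓘(ℝ, E) c.symm z (mfderiv 𝓘(ℝ, E) 𝓘(ℝ, E) c (c.symm z) v) = v := by
  have h := DFunLike.congr_fun
    ((mdifferentiable_of_mem_atlas_infty hc).symm_comp_deriv (c.map_target hz)) v
  rw [c.right_inv hz] at h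
  exact h

lemma exists_mfderiv_symm_eq_of_mem_atlas (hc : c ∈ atlas E N) (hz : z ∈ c.target)
    (v : TangentSpace 𝓘(ℝ, E) (c.symm z)) : ∃ w : E, mfderiv 𝓘(ℝ, E) 𝓘(ℝ, E) c.symm z w = v :=
  ⟨_, mfderiv_symm_mfderiv_of_mem_atlas hc hz v⟩

lemma mfderiv_symm_injective_of_mem_atlas (hc : c ∈ atlas E N) (hz : z ∈ c.target) :
    Function.Injective (mfderiv 𝓘(ℝ, E) 𝓘(ℝ, E) c.symm z) := fun v w h =>
  (mfderiv_mfderiv_symm_of_mem_atlas hc hz v).symm.trans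
    ((congrArg (mfderiv 𝓘(ℝ, E) 𝓘(ℝ, E) c (c.symm z)) h).trans
      (mfderiv_mfderiv_symm_of_mem_atlas hc hz w))

lemma contDiffAt_transition {c' : OpenPartialHomeomorph N E} (hc : c ∈ atlas E N)
    (hc' : c' ∈ atlas E N) (hz : z ∈ c.target) (hz' : c.symm z ∈ c'.source) :
    ContDiffAt ℝ ∞ (c' ∘ c.symm) z :=
  (((contMDiffOn_of_mem_maximalAtlas (IsManifold.subset_maximalAtlas hc')).contMDiffAt
      (c'.open_source.mem_nhds hz')).comp z
    ((contMDiffOn_symm_of_mem_maximalAtlas (I := 𝓘(ℝ, E))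
      (IsManifold.subset_maximalAtlas hc)).contMDiffAt (c.open_target.mem_nhds hz))).contDiffAt

lemma fderiv_transition {c' : OpenPartialHomeomorph N E} (hc : c ∈ atlas E N)
    (hc' : c' ∈ atlas E N) (hz : z ∈ c.target) (hz' : c.symm z ∈ c'.source) (v : E) :
    fderiv ℝ (c' ∘ c.symm) z v = mfderiv 𝓘(ℝ, E) 𝓘(ℝ, E) c' (c.symm z)
      (mfderiv 𝓘(ℝ, E) 𝓘(ℝ, E) c.symm z v) := by
  rw [← mfderiv_eq_fderiv]
  exact DFunLike.congr_fun
    (mfderiv_comp z ((mdifferentiable_of_mem_atlas_infty hc').mdifferentiableAt hz')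
      ((mdifferentiable_of_mem_atlas_infty hc).mdifferentiableAt_symm hz)) v

lemma mfderiv_symm_transition {c' : OpenPartialHomeomorph N E} (hc : c ∈ atlas E N)
    (hc' : c' ∈ atlas E N) {z' : E} (hz : z ∈ c.target) (hz' : z' ∈ c'.target)
    (h : c.symm z = c'.symm z') (v : E) :
    (mfderiv 𝓘(ℝ, E) 𝓘(ℝ, E) c.symm z v : E) =
      mfderiv 𝓘(ℝ, E) 𝓘(ℝ, E) c'.symm z' (fderiv ℝ (c' ∘ c.symm) z v) := by
  have hs : c.symm z ∈ c'.source := h ▸ c'.map_target hz'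
  have hz'' : z' = c' (c.symm z) := by rw [h, c'.right_inv hz']
  subst hz''
  rw [fderiv_transition hc hc' hz hs]
  exact (DFunLike.congr_fun ((mdifferentiable_of_mem_atlas_infty hc').symm_comp_deriv hs) _).symm

lemma contDiffOn_comp_symm_of_mem_atlas {f : N → ℝ} (hf : ContMDiffOn 𝓘(ℝ, E) 𝓘(ℝ, ℝ) ∞ f W)
    (hc : c ∈ atlas E N) : ContDiffOn ℝ ∞ (f ∘ c.symm) (c.target ∩ c.symm ⁻¹' W) :=
  (hf.comp ((contMDiffOn_symm_of_mem_maximalAtlas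
    (IsManifold.subset_maximalAtlas hc)).mono inter_subset_left) fun _ hz => hz.2).contDiffOn

lemma VField.mfderiv_symm_inChart (X : VField E N) (hc : c ∈ atlas E N) (hz : z ∈ c.target) :
    mfderiv 𝓘(ℝ, E) 𝓘(ℝ, E) c.symm z (X.inChart c z : E) = X (c.symm z) :=
  mfderiv_symm_mfderiv_of_mem_atlas hc hz _

lemma VField.contDiffOn_inChart {X : VField E N}
    (hX : ContMDiff 𝓘(ℝ, E) 𝓘(ℝ, E).tangent ∞ (fun u => (⟨u, X u⟩ : TangentBundle 𝓘(ℝ, E) N)))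
    (hc : c ∈ atlas E N) : ContDiffOn ℝ ∞ (X.inChart c) c.target := by
  have : IsManifold 𝓘(ℝ, E) 1 N := IsManifold.of_le (n := ∞) (by simp)
  have hcs := contMDiffOn_symm_of_mem_maximalAtlas (I := 𝓘(ℝ, E)) (n := ∞)
    (IsManifold.subset_maximalAtlas hc)
  have hTc := (contMDiffOn_of_mem_maximalAtlas (I := 𝓘(ℝ, E)) (n := ∞)
    (IsManifold.subset_maximalAtlas hc)).contMDiffOn_tangentMapWithin (m := ∞) (by simp)
      c.open_source.uniqueMDiffOn
  have h := (contMDiff_snd_tangentBundle_modelSpace (n := ∞) E 𝓘(ℝ, E)).comp_contMDiffOn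
    (hTc.comp (hX.comp_contMDiffOn hcs) fun z hz => c.map_target hz)
  refine h.contDiffOn.congr fun z hz => ?_
  exact (DFunLike.congr_fun (mfderivWithin_of_isOpen (I := 𝓘(ℝ, E)) (I' := 𝓘(ℝ, E)) (f := c)
    c.open_source (c.map_target hz)) (X (c.symm z))).symm

end Transition

namespace DForm

section Pointwise

variable (X : VField E N) (A : EndoField E N) (α β θ : DForm E N 1) (η η' : DForm E N 2)

lemma ext_one {θ θ' : DForm E N 1} (h : ∀ v, θ.eval u v = θ'.eval u v) : θ u = θ' u := by
  ext v
  rw [show v = fun _ => v 0 from funext fun i => by fin_cases i; rfl]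
  exact h (v 0)

lemma eval_congr {θ θ' : DForm E N 1} (h : θ u = θ' u) (v : TangentSpace 𝓘(ℝ, E) u) :
    θ.eval u v = θ'.eval u v := by
  rw [eval, eval, h]

lemma eval_zero (u : N) : θ.eval u 0 = 0 :=
  (θ u).map_coord_zero 0 rfl

lemma two_apply_zero_left (u : N) (v : TangentSpace 𝓘(ℝ, E) u) : η u ![0, v] = 0 :=
  (η u).map_coord_zero 0 rfl

lemma two_apply_self (u : N) (v : TangentSpace 𝓘(ℝ, E) u) : η u ![v, v] = 0 :=
  (η u).map_eq_zero_of_eq _ (i := 0) (j := 1) rfl (by decide)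

lemma two_apply_swap (u : N) (v w : TangentSpace 𝓘(ℝ, E) u) : η u ![v, w] = -η u ![w, v] := by
  refine Eq.trans ?_ ((η u).toAlternatingMap.map_swap ![w, v] (i := 0) (j := 1) (by decide))
  exact congrArg (η u) (funext fun i => by fin_cases i <;> rfl)

lemma eval_interior (u : N) (v : TangentSpace 𝓘(ℝ, E) u) :
    (interior X η).eval u v = η u ![X u, v] :=
  congrArg (η u) (funext fun i => by fin_cases i <;> rfl)

lemma interior_one : interior X θ = ofFun fun u => θ.eval u (X u) := by
  funext u
  ext v
  exact congrArg (θ u) (funext fun i => by fin_cases i; rfl)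

lemma wedge_apply (u : N) (v w : TangentSpace 𝓘(ℝ, E) u) :
    α.wedge β u ![v, w] = α.eval u v * β.eval u w - α.eval u w * β.eval u v :=
  wedgeAux_apply (E := E) (α u) (β u) ![v, w]

lemma eval_insertion (u : N) (v : TangentSpace 𝓘(ℝ, E) u) :
    (insertion A θ).eval u v = θ.eval u (A u v) := by
  rw [eval, insertion, derivationAux_apply, Fin.sum_univ_one]
  exact congrArg (θ u) (funext fun i => by fin_cases i; rfl)

lemma insertion_two_apply (u : N) (v w : TangentSpace 𝓘(ℝ, E) u) :
    insertion A η u ![v, w] = η u ![A u v, w] + η u ![v, A u w] := by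
  rw [insertion, derivationAux_apply, Fin.sum_univ_two]
  refine congrArg₂ (· + ·) ?_ ?_ <;>
    exact congrArg (η u) (funext fun i => by fin_cases i <;> rfl)

lemma inChart_two_apply (c : OpenPartialHomeomorph N E) (z v w : E) :
    η.inChart c z ![v, w] = η (c.symm z) ![mfderiv 𝓘(ℝ, E) 𝓘(ℝ, E) c.symm z v,
      mfderiv 𝓘(ℝ, E) 𝓘(ℝ, E) c.symm z w] :=
  congrArg (η (c.symm z)) (funext fun i => by fin_cases i <;> rfl)

lemma interior_congr {X : VField E N} {η η' : DForm E N (k + 1)} (h : η u = η' u) :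
    interior X η u = interior X η' u := by
  rw [interior, interior, h]

lemma rankAt_congr {η η' : DForm E N 2} (h : η u = η' u) : η.rankAt u = η'.rankAt u := by
  rw [rankAt, rankAt, h]

end Pointwise

section ExteriorDerivative

lemma extD_congr (hW : IsOpen W) {η η' : DForm E N k} (h : ∀ v ∈ W, η v = η' v) (hu : u ∈ W) :
    η.extD u = η'.extD u := by
  have hev : η.inChart (chartAt E u) =ᶠ[𝓝 (chartAt E u u)] η'.inChart (chartAt E u) := by
    have hWu : (chartAt E u).symm (chartAt E u u) ∈ W := by
      rwa [(chartAt E u).left_inv (mem_chart_source E u)]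
    filter_upwards [((chartAt E u).symm.isOpen_inter_preimage hW).mem_nhds
      ⟨mem_chart_target E u, hWu⟩] with w hw
    rw [inChart, inChart, h _ hw.2]
  rw [extD, extD, hev.extDeriv_eq]

lemma dEndo_congr (A : EndoField E N) (hW : IsOpen W) {η η' : DForm E N k}
    (h : ∀ v ∈ W, η v = η' v) (hu : u ∈ W) : dEndo A η u = dEndo A η' u := by
  have hA : ∀ v ∈ W, insertion A η v = insertion A η' v := fun v hv => by
    rw [insertion, insertion, h v hv]
  change insertion A η.extD u - (insertion A η).extD u =
    insertion A η'.extD u - (insertion A η').extD u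
  rw [extD_congr hW hA hu, insertion, insertion, extD_congr hW h hu]

lemma lie_congr (X : VField E N) (hW : IsOpen W) {η η' : DForm E N (k + 1)}
    (h : ∀ v ∈ W, η v = η' v) (hu : u ∈ W) : lie X η u = lie X η' u :=
  congrArg₂ (· + ·) (extD_congr hW (fun v hv => interior_congr (h v hv)) hu)
    (interior_congr (extD_congr hW h hu))

lemma extD_smul (r : ℝ) (η : DForm E N k) : (r • η).extD = r • η.extD := by
  funext u
  have h : (r • η).inChart (chartAt E u) = r • η.inChart (chartAt E u) := rfl
  rw [extD, h, extDeriv_smul]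
  rfl

lemma extD_zero : (0 : DForm E N k).extD = 0 := by
  simpa only [zero_smul] using extD_smul 0 (0 : DForm E N k)

lemma differential_neg (f : N → ℝ) :
    (differential (-f) : DForm E N 1) = -differential f := by
  have h : (ofFun (-f) : DForm E N 0) = (-1 : ℝ) • ofFun f := by
    funext u
    ext _
    exact (neg_one_mul (f u)).symm
  rw [differential, h, extD_smul]
  exact neg_one_smul ℝ (differential f : DForm E N 1)

lemma differential_zero : (differential (0 : N → ℝ) : DForm E N 1) = 0 :=
  extD_zero

lemma dEndo_ofFun (A : EndoField E N) (f : N → ℝ) :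
    dEndo A (ofFun f : DForm E N 0) = insertion A (differential f) := by
  have h : insertion A (ofFun f : DForm E N 0) = 0 := by
    funext u
    ext v
    rw [insertion, derivationAux_apply]
    rfl
  rw [dEndo, h, extD_zero, sub_zero, differential]

lemma lie_one (X : VField E N) (θ : DForm E N 1) :
    lie X θ = (differential fun u => θ.eval u (X u)) + interior X θ.extD := by
  rw [lie, interior_one, differential]

end ExteriorDerivative

section Smooth

variable {η η' : DForm E N k}

lemma IsSmoothOn.mono {W' : Set N} (hη : η.IsSmoothOn W) (h : W' ⊆ W) : η.IsSmoothOn W' :=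
  fun c hc => (hη c hc).mono (inter_subset_inter_right _ (preimage_mono h))

lemma IsSmoothOn.add (hη : η.IsSmoothOn W) (hη' : η'.IsSmoothOn W) : (η + η').IsSmoothOn W :=
  fun c hc => (hη c hc).add (hη' c hc)

lemma IsSmoothOn.contDiffAt (hη : η.IsSmoothOn W) (hW : IsOpen W) (hc : c ∈ atlas E N)
    (hz : z ∈ c.target) (hzW : c.symm z ∈ W) : ContDiffAt ℝ ∞ (η.inChart c) z :=
  (hη c hc).contDiffAt ((c.symm.isOpen_inter_preimage hW).mem_nhds ⟨hz, hzW⟩)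

lemma IsSmoothOn.differentiableAt (hη : η.IsSmoothOn W) (hW : IsOpen W) (hc : c ∈ atlas E N)
    (hz : z ∈ c.target) (hzW : c.symm z ∈ W) : DifferentiableAt ℝ (η.inChart c) z :=
  (hη.contDiffAt hW hc hz hzW).differentiableAt (by simp)

end Smooth

section InChart

variable [IsManifold 𝓘(ℝ, E) ∞ N] {η η' : DForm E N k} {f : N → ℝ}

lemma inChart_eq_iff (hc : c ∈ atlas E N) (hz : z ∈ c.target) :
    η.inChart c z = η'.inChart c z ↔ η (c.symm z) = η' (c.symm z) := by
  refine ⟨fun h => ?_, fun h => by rw [inChart, inChart, h]⟩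
  ext v
  have hv := DFunLike.congr_fun h fun i => mfderiv 𝓘(ℝ, E) 𝓘(ℝ, E) c (c.symm z) (v i)
  have hinv : (fun i => mfderiv 𝓘(ℝ, E) 𝓘(ℝ, E) c.symm z
      (mfderiv 𝓘(ℝ, E) 𝓘(ℝ, E) c (c.symm z) (v i))) = v :=
    funext fun i => mfderiv_symm_mfderiv_of_mem_atlas hc hz (v i)
  rw [← hinv]
  exact hv

lemma inChart_transition (η : DForm E N k) {c' : OpenPartialHomeomorph N E}
    (hc : c ∈ atlas E N) (hc' : c' ∈ atlas E N) (hz : z ∈ c.target) (hz' : c.symm z ∈ c'.source) :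
    η.inChart c z = (η.inChart c' (c' (c.symm z))).compContinuousLinearMap
      (fderiv ℝ (c' ∘ c.symm) z) := by
  have key : ∀ u, c.symm z = u → ∀ v : Fin k → E, η (c.symm z) v = η u v := by
    rintro _ rfl _; rfl
  ext v
  refine Eq.trans ?_ (key (c'.symm (c' (c.symm z))) (c'.left_inv hz').symm _)
  exact congrArg (η (c.symm z)) (funext fun i => mfderiv_symm_transition hc hc' hz
    (c'.map_source hz') (c'.left_inv hz').symm (v i))

/-- Naturality of `extDeriv` under pullback by a transition map lets any chart of the atlas replace
the preferred one. -/
lemma extD_inChart (hW : IsOpen W) (hη : η.IsSmoothOn W) (hc : c ∈ atlas E N)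
    (hz : z ∈ c.target) (hzW : c.symm z ∈ W) : η.extD.inChart c z = extDeriv (η.inChart c) z := by
  set c' := chartAt E (c.symm z)
  have hc' : c' ∈ atlas E N := chart_mem_atlas E _
  have hz' : c.symm z ∈ c'.source := mem_chart_source E _
  have hev : η.inChart c =ᶠ[𝓝 z] fun w =>
      (η.inChart c' ((c' ∘ c.symm) w)).compContinuousLinearMap (fderiv ℝ (c' ∘ c.symm) w) := by
    filter_upwards [(c.symm.isOpen_inter_preimage c'.open_source).mem_nhds ⟨hz, hz'⟩] with w hw
    exact η.inChart_transition hc hc' hw.1 hw.2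
  have hd : DifferentiableAt ℝ (η.inChart c') ((c' ∘ c.symm) z) :=
    hη.differentiableAt hW hc' (c'.map_source hz') (by rwa [Function.comp, c'.left_inv hz'])
  rw [hev.extDeriv_eq, extDeriv_pullback hd (contDiffAt_transition hc hc' hz hz')
    minSmoothness_two_le_infty]
  ext v
  exact congrArg (extDeriv (η.inChart c') (c' (c.symm z)))
    (funext fun i => (fderiv_transition hc hc' hz hz' (v i)).symm)

lemma isSmoothOn_ofFun (hf : ContMDiffOn 𝓘(ℝ, E) 𝓘(ℝ, ℝ) ∞ f W) :
    (ofFun f : DForm E N 0).IsSmoothOn W := fun _ hc =>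
  (ContinuousAlternatingMap.constOfIsEmptyLIE ℝ E ℝ (Fin 0)).contDiff.comp_contDiffOn
    (contDiffOn_comp_symm_of_mem_atlas hf hc)

lemma contMDiffOn_of_isSmoothOn_ofFun (hW : IsOpen W)
    (hf : (ofFun f : DForm E N 0).IsSmoothOn W) : ContMDiffOn 𝓘(ℝ, E) 𝓘(ℝ, ℝ) ∞ f W := by
  intro u hu
  have hc := chart_mem_atlas E u
  have hus := mem_chart_source E u
  have hfc : ContDiffAt ℝ ∞ (f ∘ (chartAt E u).symm) (chartAt E u u) :=
    (ContinuousAlternatingMap.constOfIsEmptyLIE ℝ E ℝ (Fin 0)).symm.contDiff.contDiffAt.comp _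
      (hf.contDiffAt hW hc (mem_chart_target E u) (by rwa [(chartAt E u).left_inv hus]))
  have hcu := (contMDiffOn_of_mem_maximalAtlas (I := 𝓘(ℝ, E)) (n := ∞)
    (IsManifold.subset_maximalAtlas hc)).contMDiffAt ((chartAt E u).open_source.mem_nhds hus)
  refine ((hfc.contMDiffAt.comp u hcu).congr_of_eventuallyEq ?_).contMDiffWithinAt
  filter_upwards [(chartAt E u).open_source.mem_nhds hus] with v hv
  rw [Function.comp, Function.comp, (chartAt E u).left_inv hv]

lemma differential_inChart_apply (hW : IsOpen W) (hf : ContMDiffOn 𝓘(ℝ, E) 𝓘(ℝ, ℝ) ∞ f W)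
    (hc : c ∈ atlas E N) (hz : z ∈ c.target) (hzW : c.symm z ∈ W) (v : Fin 1 → E) :
    (differential f : DForm E N 1).inChart c z v = fderiv ℝ (f ∘ c.symm) z (v 0) := by
  rw [differential, extD_inChart hW (isSmoothOn_ofFun hf) hc hz hzW]
  exact DFunLike.congr_fun (extDeriv_constOfIsEmpty (f ∘ c.symm) z) v

lemma interior_inChart (X : VField E N) (η : DForm E N (k + 1)) (hc : c ∈ atlas E N)
    (hz : z ∈ c.target) :
    (interior X η).inChart c z = (η.inChart c z).curryLeft (X.inChart c z) := by
  ext v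
  refine congrArg (η (c.symm z)) (funext fun i => ?_)
  exact Fin.cases (X.mfderiv_symm_inChart hc hz).symm (fun j => rfl) i

lemma IsSmoothOn.extD (hW : IsOpen W) (hη : η.IsSmoothOn W) : η.extD.IsSmoothOn W := by
  intro c hc
  have hd : ContDiffOn ℝ ∞ (fderiv ℝ (η.inChart c)) (c.target ∩ c.symm ⁻¹' W) :=
    (hη c hc).fderiv_of_isOpen (c.symm.isOpen_inter_preimage hW) (by simp)
  refine ((ContinuousAlternatingMap.alternatizeUncurryFinCLM ℝ E ℝ).contDiff.comp_contDiffOn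
    hd).congr fun z hz => ?_
  exact extD_inChart hW hη hc hz.1 hz.2

lemma isSmoothOn_differential (hW : IsOpen W) (hf : ContMDiffOn 𝓘(ℝ, E) 𝓘(ℝ, ℝ) ∞ f W) :
    (differential f : DForm E N 1).IsSmoothOn W :=
  (isSmoothOn_ofFun hf).extD hW

lemma IsSmoothOn.interior {X : VField E N}
    (hX : ContMDiff 𝓘(ℝ, E) 𝓘(ℝ, E).tangent ∞ (fun u => (⟨u, X u⟩ : TangentBundle 𝓘(ℝ, E) N)))
    {η : DForm E N (k + 1)} (hη : η.IsSmoothOn W) : (interior X η).IsSmoothOn W := by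
  intro c hc
  have hcurry : ContDiff ℝ ∞ (ContinuousAlternatingMap.curryLeftLI (𝕜 := ℝ) (E := E) (F := ℝ)
      (n := k)).toContinuousLinearMap := ContinuousLinearMap.contDiff _
  refine ((hcurry.comp_contDiffOn (hη c hc)).clm_apply
    ((VField.contDiffOn_inChart hX hc).mono inter_subset_left)).congr fun z hz => ?_
  exact interior_inChart X η hc hz.1

lemma contMDiffOn_eval {X : VField E N}
    (hX : ContMDiff 𝓘(ℝ, E) 𝓘(ℝ, E).tangent ∞ (fun u => (⟨u, X u⟩ : TangentBundle 𝓘(ℝ, E) N)))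
    (hW : IsOpen W) {θ : DForm E N 1} (hθ : θ.IsSmoothOn W) :
    ContMDiffOn 𝓘(ℝ, E) 𝓘(ℝ, ℝ) ∞ (fun u => θ.eval u (X u)) W :=
  contMDiffOn_of_isSmoothOn_ofFun hW (interior_one X θ ▸ hθ.interior hX)

lemma IsSmoothOn.smul (hf : ContMDiffOn 𝓘(ℝ, E) 𝓘(ℝ, ℝ) ∞ f W) (hη : η.IsSmoothOn W) :
    IsSmoothOn (fun u => f u • η u) W :=
  fun c hc => (contDiffOn_comp_symm_of_mem_atlas hf hc).smul (hη c hc)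

lemma extD_extD (hW : IsOpen W) (hη : η.IsSmoothOn W) (hu : u ∈ W) : η.extD.extD u = 0 := by
  obtain ⟨c, hc, z, hz, rfl⟩ := exists_mem_atlas_symm_eq E u
  have hev : η.extD.inChart c =ᶠ[𝓝 z] extDeriv (η.inChart c) := by
    filter_upwards [(c.symm.isOpen_inter_preimage hW).mem_nhds ⟨hz, hu⟩] with w hw
    exact extD_inChart hW hη hc hw.1 hw.2
  refine (inChart_eq_iff (η' := 0) hc hz).1 ?_
  rw [extD_inChart hW (hη.extD hW) hc hz hu, hev.extDeriv_eq,
    extDeriv_extDeriv_apply (hη.contDiffAt hW hc hz hu) minSmoothness_two_le_infty]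
  rfl

lemma extD_differential (hW : IsOpen W) (hf : ContMDiffOn 𝓘(ℝ, E) 𝓘(ℝ, ℝ) ∞ f W) (hu : u ∈ W) :
    (differential f : DForm E N 1).extD u = 0 :=
  extD_extD hW (isSmoothOn_ofFun hf) hu

lemma lie_extD (X : VField E N) (hW : IsOpen W) {η : DForm E N (k + 1)} (hη : η.IsSmoothOn W)
    (hu : u ∈ W) : lie X η.extD u = (DForm.interior X η.extD).extD u := by
  change (DForm.interior X η.extD).extD u + DForm.interior X η.extD.extD u = _
  have h : DForm.interior X η.extD.extD u = 0 :=
    interior_congr (η' := 0) (extD_extD hW hη hu)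
  rw [h, add_zero]

lemma extD_add (hW : IsOpen W) (hη : η.IsSmoothOn W) (hη' : η'.IsSmoothOn W) (hu : u ∈ W) :
    (η + η').extD u = η.extD u + η'.extD u := by
  obtain ⟨c, hc, z, hz, rfl⟩ := exists_mem_atlas_symm_eq E u
  refine (inChart_eq_iff (η' := η.extD + η'.extD) hc hz).1 ?_
  change _ = η.extD.inChart c z + η'.extD.inChart c z
  rw [extD_inChart hW (hη.add hη') hc hz hu, extD_inChart hW hη hc hz hu,
    extD_inChart hW hη' hc hz hu]
  exact extDeriv_add (hη.differentiableAt hW hc hz hu) (hη'.differentiableAt hW hc hz hu)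

lemma differential_sub (hW : IsOpen W) {g : N → ℝ} (hf : ContMDiffOn 𝓘(ℝ, E) 𝓘(ℝ, ℝ) ∞ f W)
    (hg : ContMDiffOn 𝓘(ℝ, E) 𝓘(ℝ, ℝ) ∞ g W) (hu : u ∈ W) :
    (differential (f - g) : DForm E N 1) u = differential f u - differential g u := by
  have h := extD_add hW (isSmoothOn_ofFun hf) (isSmoothOn_ofFun (f := -g) hg.neg) hu
  have hadd : (ofFun (f - g) : DForm E N 0) = ofFun f + ofFun (-g) := by
    funext u
    ext _
    exact sub_eq_add_neg (f u) (g u)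
  rw [differential, hadd, h, ← differential, ← differential, differential_neg, sub_eq_add_neg]
  rfl

lemma extD_fun_smul (hW : IsOpen W) (hf : ContMDiffOn 𝓘(ℝ, E) 𝓘(ℝ, ℝ) ∞ f W) {θ : DForm E N 1}
    (hθ : θ.IsSmoothOn W) (hu : u ∈ W) :
    extD (fun v => f v • θ v) u = (differential f).wedge θ u + f u • θ.extD u := by
  obtain ⟨c, hc, z, hz, rfl⟩ := exists_mem_atlas_symm_eq E u
  have hfz : DifferentiableAt ℝ (f ∘ c.symm) z :=
    ((contDiffOn_comp_symm_of_mem_atlas hf hc).contDiffAt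
      ((c.symm.isOpen_inter_preimage hW).mem_nhds ⟨hz, hu⟩)).differentiableAt (by simp)
  have hfd : ∀ v, fderiv ℝ (fun w => f (c.symm w) • θ.inChart c w) z v =
      (differential f : DForm E N 1).inChart c z (fun _ => v) • θ.inChart c z +
        f (c.symm z) • fderiv ℝ (θ.inChart c) z v := fun v => by
    rw [differential_inChart_apply hW hf hc hz hu, add_comm]
    exact DFunLike.congr_fun (fderiv_smul hfz (hθ.differentiableAt hW hc hz hu)) v
  refine (inChart_eq_iff (η' := (differential f).wedge θ + fun v => f v • θ.extD v) hc hz).1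
    (alternating_two_ext fun v w => ?_)
  have hθd : θ.extD (c.symm z) ![mfderiv 𝓘(ℝ, E) 𝓘(ℝ, E) c.symm z v,
      mfderiv 𝓘(ℝ, E) 𝓘(ℝ, E) c.symm z w] =
        fderiv ℝ (θ.inChart c) z v (fun _ => w) - fderiv ℝ (θ.inChart c) z w (fun _ => v) := by
    rw [← inChart_two_apply, extD_inChart hW hθ hc hz hu, extDeriv_one_apply]
  have hwedge := wedge_apply (differential f) θ (c.symm z)
    (mfderiv 𝓘(ℝ, E) 𝓘(ℝ, E) c.symm z v) (mfderiv 𝓘(ℝ, E) 𝓘(ℝ, E) c.symm z w)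
  rw [extD_inChart hW (hθ.smul hf) hc hz hu, extDeriv_one_apply]
  change fderiv ℝ (fun w => f (c.symm w) • θ.inChart c w) z v _ -
    fderiv ℝ (fun w => f (c.symm w) • θ.inChart c w) z w _ = _
  rw [hfd, hfd, inChart_two_apply]
  refine Eq.trans ?_ (congrArg₂ (· + ·) hwedge (congrArg (f (c.symm z) * ·) hθd)).symm
  change _ * _ + f (c.symm z) * _ - (_ * _ + f (c.symm z) * _) = _
  rw [mul_sub, add_sub_add_comm]
  rfl

lemma lie_one_inChart_apply {X : VField E N}
    (hX : ContMDiff 𝓘(ℝ, E) 𝓘(ℝ, E).tangent ∞ (fun u => (⟨u, X u⟩ : TangentBundle 𝓘(ℝ, E) N)))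
    (hW : IsOpen W) {θ : DForm E N 1} (hθ : θ.IsSmoothOn W) (hc : c ∈ atlas E N)
    (hz : z ∈ c.target) (hzW : c.symm z ∈ W) (v : E) :
    (lie X θ).inChart c z (fun _ => v) = fderiv ℝ (θ.inChart c) z (X.inChart c z) (fun _ => v) +
      θ.inChart c z fun _ => fderiv ℝ (X.inChart c) z v := by
  have hs : DifferentiableAt ℝ (X.inChart c) z :=
    ((VField.contDiffOn_inChart hX hc).contDiffAt (c.open_target.mem_nhds hz)).differentiableAt
      (by simp)
  have hθX : (fun u => θ.eval u (X u)) ∘ c.symm =ᶠ[𝓝 z]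
      fun w => θ.inChart c w fun _ => X.inChart c w := by
    filter_upwards [c.open_target.mem_nhds hz] with w hw
    exact congrArg (θ (c.symm w)) (funext fun _ => (X.mfderiv_symm_inChart hc hw).symm)
  have hd := differential_inChart_apply hW (contMDiffOn_eval hX hW hθ) hc hz hzW fun _ => v
  rw [hθX.fderiv_eq, fderiv_alternating_one_apply (hθ.differentiableAt hW hc hz hzW) hs] at hd
  have hi : (DForm.interior X θ.extD).inChart c z (fun _ => v) =
      extDeriv (θ.inChart c) z ![X.inChart c z, v] := by
    rw [interior_inChart X _ hc hz, extD_inChart hW hθ hc hz hzW]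
    exact congrArg (extDeriv _ z) (funext fun i => by fin_cases i <;> rfl)
  rw [lie_one]
  refine (congrArg₂ (· + ·) hd hi).trans ?_
  change _ + _ + extDeriv _ z _ = _
  rw [extDeriv_one_apply]
  ring

end InChart

section PoincareLemma

/-- Closedness of a `1`-form is the symmetry of the derivative of its coefficients. -/
lemma exists_contDiffOn_fderiv_eq_of_extDeriv_eq_zero {B : Set E} (hB : IsOpen B)
    (hconv : Convex ℝ B) {α : E → E [⋀^Fin 1]→L[ℝ] ℝ} (hα : ContDiffOn ℝ ∞ α B)
    (hclosed : ∀ w ∈ B, extDeriv α w = 0) :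
    ∃ G : E → ℝ, ContDiffOn ℝ ∞ G B ∧ ∀ w ∈ B, ∀ v, fderiv ℝ G w v = α w fun _ => v := by
  set β : E → E →L[ℝ] ℝ := (covectorEquiv E).symm ∘ α
  have hβ : ContDiffOn ℝ ∞ β B := (covectorEquiv E).symm.contDiff.comp_contDiffOn hα
  have hsymm : ∀ w ∈ B, ∀ x y, fderiv ℝ β w x y = fderiv ℝ β w y x := fun w hw x y => by
    rw [(covectorEquiv E).symm.comp_fderiv]
    refine sub_eq_zero.1 ((extDeriv_one_apply α w x y).symm.trans ?_)
    rw [hclosed w hw]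
    rfl
  obtain ⟨G, hG⟩ := hconv.exists_forall_hasFDerivAt_of_fderiv_symmetric hB
    (hβ.differentiableOn (by simp)) hsymm
  refine ⟨G, (contDiffOn_infty_iff_fderiv_of_isOpen hB).2 ⟨fun w hw =>
    (hG w hw).differentiableAt.differentiableWithinAt, hβ.congr fun w hw => (hG w hw).fderiv⟩,
    fun w hw v => ?_⟩
  rw [(hG w hw).fderiv]
  rfl

lemma exists_local_primitive [IsManifold 𝓘(ℝ, E) ∞ N] {α : DForm E N 1} (hW : IsOpen W)
    (hα : α.IsSmoothOn W) (hclosed : ∀ v ∈ W, α.extD v = 0) (hu : u ∈ W) :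
    ∃ W', IsOpen W' ∧ u ∈ W' ∧ W' ⊆ W ∧ ∃ g : N → ℝ,
      ContMDiffOn 𝓘(ℝ, E) 𝓘(ℝ, ℝ) ∞ g W' ∧ ∀ v ∈ W', α v = differential g v := by
  set c := chartAt E u
  have hc : c ∈ atlas E N := chart_mem_atlas E u
  have hus : u ∈ c.source := mem_chart_source E u
  obtain ⟨r, hr, hball⟩ := Metric.isOpen_iff.1 (c.symm.isOpen_inter_preimage hW) (c u)
    ⟨c.map_source hus, by rwa [mem_preimage, c.left_inv hus]⟩
  obtain ⟨G, hG, hGα⟩ := exists_contDiffOn_fderiv_eq_of_extDeriv_eq_zero Metric.isOpen_ball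
    (convex_ball (c u) r) ((hα c hc).mono hball) fun w hw => by
      rw [← extD_inChart hW hα hc (hball hw).1 (hball hw).2]
      exact (inChart_eq_iff (η' := 0) hc (hball hw).1).2 (hclosed _ (hball hw).2)
  have hW' : IsOpen (c.source ∩ c ⁻¹' Metric.ball (c u) r) :=
    c.isOpen_inter_preimage Metric.isOpen_ball
  have hg : ContMDiffOn 𝓘(ℝ, E) 𝓘(ℝ, ℝ) ∞ (G ∘ c) (c.source ∩ c ⁻¹' Metric.ball (c u) r) :=
    hG.contMDiffOn.comp ((contMDiffOn_of_mem_maximalAtlas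
      (IsManifold.subset_maximalAtlas hc)).mono inter_subset_left) inter_subset_right
  refine ⟨_, hW', ⟨hus, Metric.mem_ball_self hr⟩, fun v hv => ?_, G ∘ c, hg, fun v hv => ?_⟩
  · simpa only [mem_preimage, c.left_inv hv.1] using (hball hv.2).2
  · have hz : c v ∈ c.target := c.map_source hv.1
    have hev : (G ∘ c) ∘ c.symm =ᶠ[𝓝 (c v)] G := by
      filter_upwards [c.open_target.mem_nhds hz] with w hw
      exact congrArg G (c.right_inv hw)
    rw [← c.left_inv hv.1, ← inChart_eq_iff hc hz]
    ext w
    rw [differential_inChart_apply hW' hg hc hz (by rwa [c.left_inv hv.1]), hev.fderiv_eq,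
      hGα _ hv.2]
    exact congrArg (α.inChart c (c v)) (funext fun i => by fin_cases i; rfl)

end PoincareLemma

end DForm

end ChartCalculus

section JetCharts

variable {n : ℕ} {M : Type*} [TopologicalSpace M]
  [ChartedSpace (EuclideanSpace ℝ (Fin (n + 1))) M] {π : M → ℝ}

/-- The first jet prolongation of a map of `ℝ × ℝⁿ` over the identity of `ℝ`: a curve through
`p.1` with velocity `(1, p.2)` is mapped to a curve with velocity `dφ(1, p.2)`. -/
noncomputable def prolong (φ : ℝ × Rn n → ℝ × Rn n) (p : JetModel n) : JetModel n :=
  (φ p.1, (fderiv ℝ φ p.1 (1, p.2)).2)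

lemma verticalEndoCoord_apply (y : Rn n) (v : JetModel n) :
    verticalEndoCoord y v = (0, v.1.2 - v.1.1 • y) := rfl

lemma contDiff_verticalEndoCoord : ContDiff ℝ ∞ (verticalEndoCoord (n := n)) :=
  contDiff_const.clm_comp
    ((contDiff_const.sub (contDiff_const.smulRight contDiff_id)).clm_comp contDiff_const)

lemma fderiv_prolong_apply {φ : ℝ × Rn n → ℝ × Rn n} {p : JetModel n} (hφ : ContDiffAt ℝ 2 φ p.1)
    (v : JetModel n) : fderiv ℝ (prolong φ) p v = (fderiv ℝ φ p.1 v.1,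
      (fderiv ℝ (fderiv ℝ φ) p.1 v.1 (1, p.2) + fderiv ℝ φ p.1 (0, v.2)).2) := by
  have hd := (hφ.differentiableAt (by simp)).hasFDerivAt
  have hd₂ := ((hφ.fderiv_right (m := 1) (by norm_num)).differentiableAt (by simp)).hasFDerivAt
  have hone : HasFDerivAt (fun p : JetModel n => ((1, p.2) : ℝ × Rn n))
      ((0 : JetModel n →L[ℝ] ℝ).prod (ContinuousLinearMap.snd ℝ (ℝ × Rn n) (Rn n))) p :=
    (hasFDerivAt_const (1 : ℝ) p).prodMk hasFDerivAt_snd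
  have h := (hd.comp p hasFDerivAt_fst).prodMk ((hd₂.comp p hasFDerivAt_fst).clm_apply hone).snd
  exact (DFunLike.congr_fun h.fderiv v).trans (congrArg (fun x : ℝ × Rn n =>
    ((fderiv ℝ φ p.1 v.1, x.2) : JetModel n)) (add_comm _ _))

/-- A vertical vector `(0, ζ)` is prolonged to `(0, dφ(0, ζ))`, and `dφ` carries the contact vector
`(τ, ξ) - τ (1, y)` to the corresponding one over the image. -/
lemma fderiv_prolong_verticalEndoCoord {φ : ℝ × Rn n → ℝ × Rn n} {p : JetModel n}
    (hφ : ContDiffAt ℝ 2 φ p.1) (htime : ∀ᶠ q in 𝓝 p.1, (φ q).1 = q.1) (v : JetModel n) :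
    fderiv ℝ (prolong φ) p (verticalEndoCoord p.2 v) =
      verticalEndoCoord (prolong φ p).2 (fderiv ℝ (prolong φ) p v) := by
  have hfst : (fderiv ℝ φ p.1 v.1).1 = v.1.1 :=
    DFunLike.congr_fun ((hφ.differentiableAt (by simp)).hasFDerivAt.fst.unique
      (hasFDerivAt_fst.congr_of_eventuallyEq htime)) v.1
  have hcontact : ((0, v.1.2 - v.1.1 • p.2) : ℝ × Rn n) = v.1 - v.1.1 • (1, p.2) := by
    ext <;> simp
  simp only [fderiv_prolong_apply hφ, verticalEndoCoord_apply, hcontact, map_sub, map_smul,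
    map_zero, zero_apply, zero_add, hfst]
  rfl

variable [IsManifold (𝓡 (n + 1)) ∞ M]

namespace FibredChart

variable (e e' : FibredChart n π) (u₀ u₁ : J1 n π)

lemma proj_jetChart_symm {p : JetModel n} (hp : p.1 ∈ e.chart.target) :
    ((e.jetChart u₀).symm p).proj = e.chart.symm p.1 :=
  congrArg J1.proj (e.jetInv_of_mem u₀ hp)

lemma jetChart_transition_apply {p : JetModel n} (hp : p.1 ∈ e.chart.target)
    (hp' : e.chart.symm p.1 ∈ e'.chart.source) :
    e'.jetChart u₁ ((e.jetChart u₀).symm p) = prolong (e'.chart ∘ e.chart.symm) p := by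
  have hjet : (e.jetChart u₀).symm p = e.jetOfCoord p hp := e.jetInv_of_mem u₀ hp
  have hcomp : fderiv ℝ (e'.chart ∘ e.chart.symm) p.1 =
      (mfderiv (𝓡 (n + 1)) 𝓘(ℝ, ℝ × Rn n) e'.chart (e.chart.symm p.1)).comp
        (mfderiv 𝓘(ℝ, ℝ × Rn n) (𝓡 (n + 1)) e.chart.symm p.1) := by
    rw [← mfderiv_eq_fderiv]
    exact mfderiv_comp p.1 (e'.mdiffAt hp') (e.mdiffAt_symm hp)
  rw [hjet, prolong, hcomp]
  rfl

lemma fderiv_jetChart_transition_verticalEndoCoord {z : JetModel n} (hz : z.1 ∈ e.chart.target)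
    (hz' : e.chart.symm z.1 ∈ e'.chart.source) (v : JetModel n) :
    fderiv ℝ (e'.jetChart u₁ ∘ (e.jetChart u₀).symm) z (verticalEndoCoord z.2 v) =
      verticalEndoCoord (e'.jetChart u₁ ((e.jetChart u₀).symm z)).2
        (fderiv ℝ (e'.jetChart u₁ ∘ (e.jetChart u₀).symm) z v) := by
  have hs : ∀ᶠ q in 𝓝 z.1, q ∈ e.chart.target ∧ e.chart.symm q ∈ e'.chart.source :=
    (e.chart.symm.isOpen_inter_preimage e'.chart.open_source).mem_nhds ⟨hz, hz'⟩
  have hφ : ContDiffAt ℝ ∞ (e'.chart ∘ e.chart.symm) z.1 :=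
    (((e'.smooth.contMDiffAt (e'.chart.open_source.mem_nhds hz')).comp z.1
      (e.smooth_symm.contMDiffAt (e.chart.open_target.mem_nhds hz)))).contDiffAt
  have htime : ∀ᶠ q in 𝓝 z.1, ((e'.chart ∘ e.chart.symm) q).1 = q.1 := by
    filter_upwards [hs] with q hq
    rw [Function.comp, e'.fst_eq _ hq.2, ← e.fst_eq _ (e.chart.map_target hq.1),
      e.chart.right_inv hq.1]
  have hev : e'.jetChart u₁ ∘ (e.jetChart u₀).symm =ᶠ[𝓝 z] prolong (e'.chart ∘ e.chart.symm) := by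
    filter_upwards [continuous_fst.continuousAt.eventually hs] with p hp
    exact e.jetChart_transition_apply e' u₀ u₁ hp.1 hp.2
  rw [hev.fderiv_eq, e.jetChart_transition_apply e' u₀ u₁ hz hz']
  exact fderiv_prolong_verticalEndoCoord (hφ.of_le (WithTop.coe_le_coe.2 le_top)) htime v

variable [IsFibredOverReal n π]

lemma jetChart_mem_atlas : e.jetChart u₀ ∈ atlas (JetModel n) (J1 n π) :=
  ⟨e, u₀, rfl⟩

lemma mfderiv_proj {u : J1 n π} (hu : u ∈ (e.jetChart u₀).source)
    (v : TangentSpace 𝓘(ℝ, JetModel n) u) :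
    (mfderiv 𝓘(ℝ, JetModel n) (𝓡 (n + 1)) (J1.proj : J1 n π → M) u v :
      EuclideanSpace ℝ (Fin (n + 1))) =
        mfderiv 𝓘(ℝ, ℝ × Rn n) (𝓡 (n + 1)) e.chart.symm (e.jetChart u₀ u).1
          (mfderiv 𝓘(ℝ, JetModel n) 𝓘(ℝ, JetModel n) (e.jetChart u₀) u v : JetModel n).1 := by
  have hjet := ((mdifferentiable_of_mem_atlas_infty
    (e.jetChart_mem_atlas u₀)).mdifferentiableAt hu).hasMFDerivAt
  have hfst : HasMFDerivAt 𝓘(ℝ, JetModel n) 𝓘(ℝ, ℝ × Rn n) (fun p : JetModel n => p.1)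
      (e.jetChart u₀ u) (ContinuousLinearMap.fst ℝ (ℝ × Rn n) (Rn n)) :=
    hasFDerivAt_fst.hasMFDerivAt
  have hsymm := (e.mdiffAt_symm (e.chart.map_source hu)).hasMFDerivAt
  have hproj : (J1.proj : J1 n π → M) =ᶠ[𝓝 u]
      e.chart.symm ∘ (fun p : JetModel n => p.1) ∘ e.jetChart u₀ := by
    filter_upwards [(e.jetChart u₀).open_source.mem_nhds hu] with a ha
    exact (e.chart.left_inv ha).symm
  exact DFunLike.congr_fun
    ((HasMFDerivAt.comp u hsymm (hfst.comp u hjet)).congr_of_eventuallyEq hproj).mfderiv v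

end FibredChart

variable [IsFibredOverReal n π] {c : OpenPartialHomeomorph (J1 n π) (JetModel n)} {z : JetModel n}

lemma mfderiv_proj_mfderiv_symm_eq_zero_iff (hc : c ∈ atlas (JetModel n) (J1 n π))
    (hz : z ∈ c.target) (w : JetModel n) :
    mfderiv 𝓘(ℝ, JetModel n) (𝓡 (n + 1)) (J1.proj : J1 n π → M) (c.symm z)
      (mfderiv 𝓘(ℝ, JetModel n) 𝓘(ℝ, JetModel n) c.symm z w) = 0 ↔ w.1 = 0 := by
  have hw := mfderiv_mfderiv_symm_of_mem_atlas hc hz w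
  obtain ⟨e, u₀, rfl⟩ := hc
  have hproj := e.mfderiv_proj u₀ ((e.jetChart u₀).map_target hz)
    (mfderiv 𝓘(ℝ, JetModel n) 𝓘(ℝ, JetModel n) (e.jetChart u₀).symm z w)
  rw [(e.jetChart u₀).right_inv hz] at hproj
  replace hproj := hproj.trans (congrArg (fun x : JetModel n =>
    mfderiv 𝓘(ℝ, ℝ × Rn n) (𝓡 (n + 1)) e.chart.symm z.1 x.1) hw)
  refine Iff.trans (Eq.congr_left hproj) ⟨fun h => ?_, fun h => ?_⟩
  · exact (e.mfderiv_mfderiv_symm hz w.1).symm.trans ((congrArg _ h).trans (map_zero _))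
  · exact (congrArg _ h).trans (map_zero _)

lemma proj_fst_symm (hc : c ∈ atlas (JetModel n) (J1 n π)) (hz : z ∈ c.target) :
    π (c.symm z).proj = z.1.1 := by
  obtain ⟨e, u₀, rfl⟩ := hc
  rw [e.proj_jetChart_symm u₀ hz, ← e.fst_eq _ (e.chart.map_target hz), e.chart.right_inv hz]

variable (n π) in
lemma contMDiffOn_time :
    ContMDiffOn 𝓘(ℝ, JetModel n) 𝓘(ℝ, ℝ) ∞ (fun u : J1 n π => π u.proj) univ := by
  refine DForm.contMDiffOn_of_isSmoothOn_ofFun isOpen_univ fun c hc => ?_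
  have htime : ContDiff ℝ ∞ fun z : JetModel n => z.1.1 := contDiff_fst.fst
  refine ((ContinuousAlternatingMap.constOfIsEmptyLIE ℝ (JetModel n) ℝ
    (Fin 0)).contDiff.comp htime).contDiffOn.congr fun z hz => ?_
  exact congrArg (ContinuousAlternatingMap.constOfIsEmpty ℝ (JetModel n) (Fin 0))
    (proj_fst_symm hc hz.1)

lemma isSmoothOn_dtForm (W : Set (J1 n π)) : (dtForm n π).IsSmoothOn W :=
  (DForm.isSmoothOn_differential isOpen_univ (contMDiffOn_time n π)).mono (subset_univ W)

lemma dtForm_eval_mfderiv_symm (hc : c ∈ atlas (JetModel n) (J1 n π)) (hz : z ∈ c.target)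
    (w : JetModel n) : (dtForm n π).eval (c.symm z)
      (mfderiv 𝓘(ℝ, JetModel n) 𝓘(ℝ, JetModel n) c.symm z w) = w.1.1 := by
  have htime : (fun u : J1 n π => π u.proj) ∘ c.symm =ᶠ[𝓝 z] fun w => w.1.1 := by
    filter_upwards [c.open_target.mem_nhds hz] with w hw
    exact proj_fst_symm hc hw
  refine (DForm.differential_inChart_apply isOpen_univ (contMDiffOn_time n π) hc hz trivial
    fun _ => w).trans ?_
  rw [htime.fderiv_eq, (hasFDerivAt_fst (p := z)).fst.fderiv]
  rfl

lemma verticalEndo_mfderiv_symm (hc : c ∈ atlas (JetModel n) (J1 n π)) (hz : z ∈ c.target)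
    (v : JetModel n) :
    verticalEndo n π (c.symm z) (mfderiv 𝓘(ℝ, JetModel n) 𝓘(ℝ, JetModel n) c.symm z v) =
      mfderiv 𝓘(ℝ, JetModel n) 𝓘(ℝ, JetModel n) c.symm z (verticalEndoCoord z.2 v) := by
  set c' := chartAt (JetModel n) (c.symm z)
  have hc' : c' ∈ atlas (JetModel n) (J1 n π) := chart_mem_atlas _ _
  have hzc' : c.symm z ∈ c'.source := mem_chart_source _ _
  have hcomm : fderiv ℝ (c' ∘ c.symm) z (verticalEndoCoord z.2 v) =
      verticalEndoCoord (c' (c.symm z)).2 (fderiv ℝ (c' ∘ c.symm) z v) := by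
    clear_value c'
    obtain ⟨e, u₀, rfl⟩ := hc
    obtain ⟨e', u₁, rfl⟩ := hc'
    refine e.fderiv_jetChart_transition_verticalEndoCoord e' u₀ u₁ hz ?_ v
    rwa [← e.proj_jetChart_symm u₀ hz]
  refine Eq.trans ?_ (mfderiv_symm_transition hc hc' hz (c'.map_source hzc')
    (c'.left_inv hzc').symm (verticalEndoCoord z.2 v)).symm
  rw [hcomm, fderiv_transition hc hc' hz hzc']
  rfl

lemma mfderiv_proj_eq_zero_iff {u : J1 n π} (v : TangentSpace 𝓘(ℝ, JetModel n) u) :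
    mfderiv 𝓘(ℝ, JetModel n) (𝓡 (n + 1)) (J1.proj : J1 n π → M) u v = 0 ↔
      ∃ w, verticalEndo n π u w = v := by
  obtain ⟨c, hc, z, hz, rfl⟩ := exists_mem_atlas_symm_eq (JetModel n) u
  obtain ⟨v, rfl⟩ := exists_mfderiv_symm_eq_of_mem_atlas hc hz v
  rw [mfderiv_proj_mfderiv_symm_eq_zero_iff hc hz]
  refine ⟨fun hv => ⟨mfderiv 𝓘(ℝ, JetModel n) 𝓘(ℝ, JetModel n) c.symm z ((0, v.2), 0), ?_⟩, ?_⟩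
  · rw [verticalEndo_mfderiv_symm hc hz, verticalEndoCoord_apply, zero_smul, sub_zero]
    exact congrArg _ (Prod.ext hv.symm rfl)
  · rintro ⟨w, hw⟩
    obtain ⟨w, rfl⟩ := exists_mfderiv_symm_eq_of_mem_atlas hc hz w
    rw [verticalEndo_mfderiv_symm hc hz] at hw
    rw [← (mfderiv_symm_injective_of_mem_atlas hc hz hw)]
    rfl

lemma verticalEndo_verticalEndo (u : J1 n π) (v : TangentSpace 𝓘(ℝ, JetModel n) u) :
    verticalEndo n π u (verticalEndo n π u v) = 0 := by
  obtain ⟨c, hc, z, hz, rfl⟩ := exists_mem_atlas_symm_eq (JetModel n) u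
  obtain ⟨v, rfl⟩ := exists_mfderiv_symm_eq_of_mem_atlas hc hz v
  rw [verticalEndo_mfderiv_symm hc hz, verticalEndo_mfderiv_symm hc hz]
  have h : verticalEndoCoord z.2 (verticalEndoCoord z.2 v) = 0 := by
    simp [verticalEndoCoord_apply]
  exact (congrArg _ h).trans (map_zero _)

lemma dtForm_eval_verticalEndo (u : J1 n π) (v : TangentSpace 𝓘(ℝ, JetModel n) u) :
    (dtForm n π).eval u (verticalEndo n π u v) = 0 := by
  obtain ⟨c, hc, z, hz, rfl⟩ := exists_mem_atlas_symm_eq (JetModel n) u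
  obtain ⟨v, rfl⟩ := exists_mfderiv_symm_eq_of_mem_atlas hc hz v
  rw [verticalEndo_mfderiv_symm hc hz, dtForm_eval_mfderiv_symm hc hz]
  rfl

lemma IsSemispray.inChart_fst {S : VField (JetModel n) (J1 n π)} (hS : IsSemispray S)
    (hc : c ∈ atlas (JetModel n) (J1 n π)) (hz : z ∈ c.target) :
    (S.inChart c z).1 = (1, z.2) := by
  have htime := hS.time (c.symm z)
  have hvert := hS.vertical (c.symm z)
  rw [← S.mfderiv_symm_inChart hc hz] at htime hvert
  rw [dtForm_eval_mfderiv_symm hc hz] at htime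
  rw [verticalEndo_mfderiv_symm hc hz] at hvert
  have h := congrArg Prod.snd (mfderiv_symm_injective_of_mem_atlas hc hz
    (hvert.trans (map_zero _).symm))
  refine Prod.ext htime ?_
  rw [verticalEndoCoord_apply, htime, one_smul] at h
  exact sub_eq_zero.1 h

end JetCharts

section JetForms

variable {n : ℕ} {M : Type*} [TopologicalSpace M]
  [ChartedSpace (EuclideanSpace ℝ (Fin (n + 1))) M] [IsManifold (𝓡 (n + 1)) ∞ M]
  {π : M → ℝ} [IsFibredOverReal n π] {S : VField (JetModel n) (J1 n π)}
  {θ : DForm (JetModel n) (J1 n π) 1} {L f : J1 n π → ℝ} {W : Set (J1 n π)} {u : J1 n π}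
  {c : OpenPartialHomeomorph (J1 n π) (JetModel n)} {z : JetModel n}

lemma isSemibasicOn_iff :
    IsSemibasicOn θ W ↔ ∀ u ∈ W, ∀ v, θ.eval u (verticalEndo n π u v) = 0 := by
  refine ⟨fun h u hu v => h u hu _ ((mfderiv_proj_eq_zero_iff _).2 ⟨v, rfl⟩), fun h u hu v hv => ?_⟩
  obtain ⟨w, rfl⟩ := (mfderiv_proj_eq_zero_iff v).1 hv
  exact h u hu w

namespace IsSemibasicOn

lemma inChart_eq_zero (hθ : IsSemibasicOn θ W) (hc : c ∈ atlas (JetModel n) (J1 n π))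
    (hz : z ∈ c.target) (hzW : c.symm z ∈ W) {w : JetModel n} (hw : w.1 = 0) :
    (θ.inChart c z fun _ => w) = 0 :=
  hθ _ hzW _ ((mfderiv_proj_mfderiv_symm_eq_zero_iff hc hz w).2 hw)

lemma inChart_congr (hθ : IsSemibasicOn θ W) (hc : c ∈ atlas (JetModel n) (J1 n π))
    (hz : z ∈ c.target) (hzW : c.symm z ∈ W) {v w : JetModel n} (h : v.1 = w.1) :
    (θ.inChart c z fun _ => v) = θ.inChart c z fun _ => w := by
  have hvw := hθ.inChart_eq_zero hc hz hzW (w := v - w) (sub_eq_zero.2 h)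
  exact sub_eq_zero.1
    ((map_sub ((covectorEquiv (JetModel n)).symm (θ.inChart c z)) v w).symm.trans hvw)

lemma fderiv_inChart_eq_zero (hθ : IsSemibasicOn θ W) (hsmooth : θ.IsSmoothOn W) (hW : IsOpen W)
    (hc : c ∈ atlas (JetModel n) (J1 n π)) (hz : z ∈ c.target) (hzW : c.symm z ∈ W) (x : JetModel n)
    {w : JetModel n} (hw : w.1 = 0) : (fderiv ℝ (θ.inChart c) z x fun _ => w) = 0 := by
  have hconst : (fun y => θ.inChart c y fun _ => w) =ᶠ[𝓝 z] fun _ => 0 := by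
    filter_upwards [(c.symm.isOpen_inter_preimage hW).mem_nhds ⟨hz, hzW⟩] with y hy
    exact hθ.inChart_eq_zero hc hy.1 hy.2 hw
  rw [← fderiv_alternating_one_const_apply (hsmooth.differentiableAt hW hc hz hzW),
    hconst.fderiv_eq, fderiv_fun_const]
  rfl

/-- In coordinates `[S, ∂/∂yⁱ]` is `-∂/∂xⁱ` up to vertical vectors. -/
lemma lie_eval_verticalEndo (hθ : IsSemibasicOn θ W) (hsmooth : θ.IsSmoothOn W) (hW : IsOpen W)
    (hS : IsSemispray S) (hu : u ∈ W) (v : TangentSpace 𝓘(ℝ, JetModel n) u) :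
    (DForm.lie S θ).eval u (verticalEndo n π u v) =
      θ.eval u v - (dtForm n π).eval u v * θ.eval u (S u) := by
  obtain ⟨c, hc, z, hz, rfl⟩ := exists_mem_atlas_symm_eq (JetModel n) u
  obtain ⟨v, rfl⟩ := exists_mfderiv_symm_eq_of_mem_atlas hc hz v
  have hs : DifferentiableAt ℝ (S.inChart c) z :=
    ((VField.contDiffOn_inChart hS.smooth hc).contDiffAt
      (c.open_target.mem_nhds hz)).differentiableAt (by simp)
  have hfst : ∀ x, (fderiv ℝ (S.inChart c) z x).1 = (0, x.2) := by
    have hev : (fun w => (S.inChart c w).1) =ᶠ[𝓝 z] fun w => (1, w.2) := by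
      filter_upwards [c.open_target.mem_nhds hz] with w hw
      exact hS.inChart_fst hc hw
    exact DFunLike.congr_fun (hs.hasFDerivAt.fst.unique
      (((hasFDerivAt_const (1 : ℝ) z).prodMk hasFDerivAt_snd).congr_of_eventuallyEq hev))
  rw [verticalEndo_mfderiv_symm hc hz, dtForm_eval_mfderiv_symm hc hz,
    ← S.mfderiv_symm_inChart hc hz]
  refine (DForm.lie_one_inChart_apply hS.smooth hW hsmooth hc hz hu _).trans ?_
  rw [hθ.fderiv_inChart_eq_zero hsmooth hW hc hz hu _ rfl, zero_add,
    hθ.inChart_congr hc hz hu (w := v - v.1.1 • S.inChart c z)]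
  · have hlin := map_sub ((covectorEquiv (JetModel n)).symm (θ.inChart c z)) v
      (v.1.1 • S.inChart c z)
    rw [map_smul] at hlin
    exact hlin
  · rw [hfst, verticalEndoCoord_apply, Prod.fst_sub, Prod.smul_fst, hS.inChart_fst hc hz]
    ext <;> simp

end IsSemibasicOn

lemma insertion_verticalEndo_inChart_apply (θ : DForm (JetModel n) (J1 n π) 1)
    (hc : c ∈ atlas (JetModel n) (J1 n π)) (hz : z ∈ c.target) (v : JetModel n) :
    ((DForm.insertion (verticalEndo n π) θ).inChart c z fun _ => v) =
      θ.inChart c z fun _ => verticalEndoCoord z.2 v :=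
  (DForm.eval_insertion _ θ (c.symm z) _).trans
    (congrArg (θ.eval (c.symm z)) (verticalEndo_mfderiv_symm hc hz v))

lemma isSmoothOn_insertion_verticalEndo (hθ : θ.IsSmoothOn W) :
    (DForm.insertion (verticalEndo n π) θ).IsSmoothOn W := fun c hc => by
  have hsmooth : ContDiffOn ℝ ∞ (fun z : JetModel n => covectorEquiv (JetModel n)
      (((covectorEquiv (JetModel n)).symm (θ.inChart c z)).comp (verticalEndoCoord z.2)))
      (c.target ∩ c.symm ⁻¹' W) :=
    (covectorEquiv (JetModel n)).contDiff.comp_contDiffOn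
      (((covectorEquiv (JetModel n)).symm.contDiff.comp_contDiffOn (hθ c hc)).clm_comp
        (contDiff_verticalEndoCoord.comp contDiff_snd).contDiffOn)
  refine hsmooth.congr fun z hz => ContinuousAlternatingMap.ext fun v => ?_
  have hv : v = fun _ => v 0 := funext fun i => by fin_cases i; rfl
  rw [hv]
  exact insertion_verticalEndo_inChart_apply θ hc hz.1 (v 0)

section PoincareCartan

lemma poincareCartan_eval (L : J1 n π → ℝ) (u : J1 n π) (v : TangentSpace 𝓘(ℝ, JetModel n) u) :
    (poincareCartan L).eval u v = L u * (dtForm n π).eval u v +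
      (DForm.differential L).eval u (verticalEndo n π u v) := by
  rw [poincareCartan, dJ, DForm.dEndo_ofFun, ← DForm.eval_insertion]
  rfl

lemma isSmoothOn_smulDt (hf : ContMDiffOn 𝓘(ℝ, JetModel n) 𝓘(ℝ, ℝ) ∞ f W) :
    (smulDt f).IsSmoothOn W :=
  (isSmoothOn_dtForm W).smul hf

lemma isSmoothOn_poincareCartan (hW : IsOpen W)
    (hL : ContMDiffOn 𝓘(ℝ, JetModel n) 𝓘(ℝ, ℝ) ∞ L W) : (poincareCartan L).IsSmoothOn W := by
  rw [poincareCartan, dJ, DForm.dEndo_ofFun]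
  exact (isSmoothOn_smulDt hL).add
    (isSmoothOn_insertion_verticalEndo (DForm.isSmoothOn_differential hW hL))

lemma isSemibasicOn_smulDt (f : J1 n π → ℝ) (W : Set (J1 n π)) : IsSemibasicOn (smulDt f) W :=
  isSemibasicOn_iff.2 fun u _ v =>
    (congrArg (f u * ·) (dtForm_eval_verticalEndo u v)).trans (mul_zero _)

lemma isSemibasicOn_poincareCartan (L : J1 n π → ℝ) (W : Set (J1 n π)) :
    IsSemibasicOn (poincareCartan L) W :=
  isSemibasicOn_iff.2 fun u _ v => by
    rw [poincareCartan_eval, dtForm_eval_verticalEndo, verticalEndo_verticalEndo, DForm.eval_zero,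
      mul_zero, add_zero]

lemma poincareCartan_inChart_apply (hW : IsOpen W)
    (hL : ContMDiffOn 𝓘(ℝ, JetModel n) 𝓘(ℝ, ℝ) ∞ L W) (hc : c ∈ atlas (JetModel n) (J1 n π))
    (hz : z ∈ c.target) (hzW : c.symm z ∈ W) (v : JetModel n) :
    ((poincareCartan L).inChart c z fun _ => v) =
      (L ∘ c.symm) z * v.1.1 + fderiv ℝ (L ∘ c.symm) z (verticalEndoCoord z.2 v) := by
  rw [poincareCartan, dJ, DForm.dEndo_ofFun]
  exact congrArg₂ (· + ·) (congrArg (L (c.symm z) * ·) (dtForm_eval_mfderiv_symm hc hz v))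
    ((insertion_verticalEndo_inChart_apply _ hc hz v).trans
      (DForm.differential_inChart_apply hW hL hc hz hzW _))

/-- The term `dl(w) τ` cancels because `J` depends on the base point through `-τ y`. -/
lemma fderiv_poincareCartanCoord {l : JetModel n → ℝ} (hl : ContDiffAt ℝ 2 l z)
    (v w : JetModel n) :
    fderiv ℝ (fun p => l p * w.1.1 + fderiv ℝ l p (verticalEndoCoord p.2 w)) z
        (verticalEndoCoord z.2 v) =
      fderiv ℝ (fderiv ℝ l) z (verticalEndoCoord z.2 v) (verticalEndoCoord z.2 w) := by
  have hd := (hl.differentiableAt (by simp)).hasFDerivAt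
  have hd₂ := ((hl.fderiv_right (m := 1) (by norm_num)).differentiableAt (by simp)).hasFDerivAt
  have hJ : HasFDerivAt (fun p : JetModel n => verticalEndoCoord p.2 w)
      ((0 : JetModel n →L[ℝ] ℝ × Rn n).prod
        (0 - w.1.1 • ContinuousLinearMap.snd ℝ (ℝ × Rn n) (Rn n))) z :=
    (hasFDerivAt_const (0 : ℝ × Rn n) z).prodMk
      ((hasFDerivAt_const w.1.2 z).sub (hasFDerivAt_snd.const_smul w.1.1))
  have hJv : ((0 : JetModel n →L[ℝ] ℝ × Rn n).prod
      (0 - w.1.1 • ContinuousLinearMap.snd ℝ (ℝ × Rn n) (Rn n))) (verticalEndoCoord z.2 v) =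
      -(w.1.1 • verticalEndoCoord z.2 v) := by
    simp [verticalEndoCoord_apply]
  rw [((hd.mul_const w.1.1).fun_add (hd₂.clm_apply hJ)).fderiv]
  simp only [add_apply, smul_apply, ContinuousLinearMap.comp_apply, ContinuousLinearMap.flip_apply,
    hJv, map_neg, map_smul, smul_eq_mul]
  ring

lemma extDeriv_poincareCartan_inChart_apply (hW : IsOpen W)
    (hL : ContMDiffOn 𝓘(ℝ, JetModel n) 𝓘(ℝ, ℝ) ∞ L W) (hc : c ∈ atlas (JetModel n) (J1 n π))
    (hz : z ∈ c.target) (hzW : c.symm z ∈ W) (v w : JetModel n) :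
    extDeriv ((poincareCartan L).inChart c) z ![verticalEndoCoord z.2 v, w] =
      fderiv ℝ (fderiv ℝ (L ∘ c.symm)) z (verticalEndoCoord z.2 v) (verticalEndoCoord z.2 w) := by
  have hθ := isSmoothOn_poincareCartan hW hL
  have hl : ContDiffAt ℝ 2 (L ∘ c.symm) z :=
    ((contDiffOn_comp_symm_of_mem_atlas hL hc).contDiffAt
      ((c.symm.isOpen_inter_preimage hW).mem_nhds ⟨hz, hzW⟩)).of_le (WithTop.coe_le_coe.2 le_top)
  have hev : (fun p => (poincareCartan L).inChart c p fun _ => w) =ᶠ[𝓝 z] fun p =>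
      (L ∘ c.symm) p * w.1.1 + fderiv ℝ (L ∘ c.symm) p (verticalEndoCoord p.2 w) := by
    filter_upwards [(c.symm.isOpen_inter_preimage hW).mem_nhds ⟨hz, hzW⟩] with p hp
    exact poincareCartan_inChart_apply hW hL hc hp.1 hp.2 w
  have hfd := fderiv_alternating_one_const_apply (hθ.differentiableAt hW hc hz hzW) w
    (verticalEndoCoord z.2 v)
  rw [extDeriv_one_apply, (isSemibasicOn_poincareCartan L W).fderiv_inChart_eq_zero hθ hW hc hz hzW
    w rfl, sub_zero, ← hfd, hev.fderiv_eq, fderiv_poincareCartanCoord hl]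

lemma extD_poincareCartan_verticalEndo_swap (hW : IsOpen W)
    (hL : ContMDiffOn 𝓘(ℝ, JetModel n) 𝓘(ℝ, ℝ) ∞ L W) (hu : u ∈ W)
    (v w : TangentSpace 𝓘(ℝ, JetModel n) u) :
    (poincareCartan L).extD u ![verticalEndo n π u v, w] =
      (poincareCartan L).extD u ![verticalEndo n π u w, v] := by
  obtain ⟨c, hc, z, hz, rfl⟩ := exists_mem_atlas_symm_eq (JetModel n) u
  obtain ⟨v, rfl⟩ := exists_mfderiv_symm_eq_of_mem_atlas hc hz v
  obtain ⟨w, rfl⟩ := exists_mfderiv_symm_eq_of_mem_atlas hc hz w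
  have hl : ContDiffAt ℝ 2 (L ∘ c.symm) z :=
    ((contDiffOn_comp_symm_of_mem_atlas hL hc).contDiffAt
      ((c.symm.isOpen_inter_preimage hW).mem_nhds ⟨hz, hu⟩)).of_le (WithTop.coe_le_coe.2 le_top)
  have hcoord (x y : JetModel n) : (poincareCartan L).extD (c.symm z)
      ![verticalEndo n π (c.symm z) (mfderiv 𝓘(ℝ, JetModel n) 𝓘(ℝ, JetModel n) c.symm z x),
        mfderiv 𝓘(ℝ, JetModel n) 𝓘(ℝ, JetModel n) c.symm z y] =
      fderiv ℝ (fderiv ℝ (L ∘ c.symm)) z (verticalEndoCoord z.2 x) (verticalEndoCoord z.2 y) := by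
    rw [verticalEndo_mfderiv_symm hc hz, ← extDeriv_poincareCartan_inChart_apply hW hL hc hz hu,
      ← DForm.extD_inChart hW (isSmoothOn_poincareCartan hW hL) hc hz hu, DForm.inChart_two_apply]
  exact (hcoord v w).trans ((hl.isSymmSndFDerivAt (by simp) _ _).trans (hcoord w v).symm)

/-- On semi-basic forms `i_J` vanishes, so that `d_J` reduces to `i_J ∘ d`. -/
lemma IsSemibasicOn.dJ_apply (hθ : IsSemibasicOn θ W) (hW : IsOpen W) (hu : u ∈ W)
    (v w : TangentSpace 𝓘(ℝ, JetModel n) u) :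
    dJ θ u ![v, w] = θ.extD u ![verticalEndo n π u v, w] + θ.extD u ![v, verticalEndo n π u w] := by
  have hins : ∀ u ∈ W, DForm.insertion (verticalEndo n π) θ u = (0 : DForm _ _ 1) u :=
    fun u hu => DForm.ext_one fun v =>
      (DForm.eval_insertion _ θ u v).trans (isSemibasicOn_iff.1 hθ u hu v)
  have hextD : (DForm.insertion (verticalEndo n π) θ).extD u = 0 :=
    (DForm.extD_congr hW hins hu).trans (congrFun DForm.extD_zero u)
  rw [← DForm.insertion_two_apply, dJ, DForm.dEndo, Pi.sub_apply, hextD, sub_zero]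

lemma dJ_poincareCartan (hW : IsOpen W) (hL : ContMDiffOn 𝓘(ℝ, JetModel n) 𝓘(ℝ, ℝ) ∞ L W)
    (hu : u ∈ W) : dJ (poincareCartan L) u = 0 :=
  alternating_two_ext fun v w => by
    rw [(isSemibasicOn_poincareCartan L W).dJ_apply hW hu, DForm.two_apply_swap _ u v,
      extD_poincareCartan_verticalEndo_swap hW hL hu, add_neg_cancel]
    rfl

end PoincareCartan

lemma extD_smulDt (hW : IsOpen W) (hf : ContMDiffOn 𝓘(ℝ, JetModel n) 𝓘(ℝ, ℝ) ∞ f W) (hu : u ∈ W) :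
    (smulDt f).extD u = (DForm.differential f).wedge (dtForm n π) u := by
  have hclosed : (dtForm n π).extD u = 0 :=
    DForm.extD_differential isOpen_univ (contMDiffOn_time n π) (mem_univ u)
  refine (DForm.extD_fun_smul hW hf (isSmoothOn_dtForm W) hu).trans ?_
  rw [hclosed, smul_zero, add_zero]

lemma IsSemispray.poincareCartan_eval_self (hS : IsSemispray S) (L : J1 n π → ℝ) (u : J1 n π) :
    (poincareCartan L).eval u (S u) = L u := by
  rw [poincareCartan_eval, hS.time, hS.vertical, DForm.eval_zero, mul_one, add_zero]

lemma IsSemispray.interior_add_wedge_dtForm (hS : IsSemispray S)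
    (η : DForm (JetModel n) (J1 n π) 2) (u : J1 n π) :
    DForm.interior S (η + (DForm.interior S η).wedge (dtForm n π)) u =
      (0 : DForm (JetModel n) (J1 n π) 1) u :=
  DForm.ext_one fun v => by
    rw [DForm.eval_interior]
    refine (congrArg (η u ![S u, v] + ·) (DForm.wedge_apply _ _ u (S u) v)).trans ?_
    rw [DForm.eval_interior, DForm.eval_interior, DForm.two_apply_self, hS.time]
    exact (congrArg _ (by ring)).trans (add_neg_cancel (η u ![S u, v]))

/-- Since `θ_L(S) = L`, the equation `L_S θ_L = dL` says that `i_S dθ_L = 0`. -/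
lemma isLagrangianFor_iff (hS : IsSemispray S) : IsLagrangianFor S L W ↔
    IsRegularLagrangianOn L W ∧ ∀ u ∈ W, DForm.interior S (poincareCartan L).extD u = 0 := by
  refine and_congr_right fun _ => forall₂_congr fun u _ => ?_
  rw [DForm.lie_one, funext (hS.poincareCartan_eval_self L)]
  exact add_eq_left

/-- `f` is a smooth function on `W` with `i_S dθ = -df`. For `θ = θ_L + f dt` with a Lagrangian `L`
for `S` and a first integral `f`, the latter is recovered from `θ` as such a potential. -/
def IsPotentialOn (S : VField (JetModel n) (J1 n π)) (θ : DForm (JetModel n) (J1 n π) 1)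
    (f : J1 n π → ℝ) (W : Set (J1 n π)) : Prop :=
  ContMDiffOn 𝓘(ℝ, JetModel n) 𝓘(ℝ, ℝ) ∞ f W ∧
    ∀ u ∈ W, DForm.interior S θ.extD u =
      (-DForm.differential f : DForm (JetModel n) (J1 n π) 1) u

/-- The function `θ(S) - f`, which is the Lagrangian of `θ` when `f` is a potential of `θ`. -/
noncomputable def lagrangianPart (S : VField (JetModel n) (J1 n π))
    (θ : DForm (JetModel n) (J1 n π) 1) (f : J1 n π → ℝ) : J1 n π → ℝ :=
  (fun u => θ.eval u (S u)) - f

lemma IsSemibasicOn.eval_eq (hsemi : IsSemibasicOn θ W) (hθ : θ.IsSmoothOn W) (hW : IsOpen W)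
    (hS : IsSemispray S) (hu : u ∈ W) (v : TangentSpace 𝓘(ℝ, JetModel n) u) :
    θ.eval u v = θ.eval u (S u) * (dtForm n π).eval u v +
      ((DForm.differential fun w => θ.eval w (S w)).eval u (verticalEndo n π u v) +
        (DForm.interior S θ.extD).eval u (verticalEndo n π u v)) := by
  have hlie := hsemi.lie_eval_verticalEndo hθ hW hS hu v
  rw [DForm.lie_one] at hlie
  rw [mul_comm, ← sub_eq_iff_eq_add', ← hlie]
  rfl

namespace IsPotentialOn

lemma interior_eval (hf : IsPotentialOn S θ f W) (hu : u ∈ W)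
    (v : TangentSpace 𝓘(ℝ, JetModel n) u) :
    (DForm.interior S θ.extD).eval u v = -(DForm.differential f).eval u v :=
  DForm.eval_congr (hf.2 u hu) v

lemma isFirstIntegralOn (hf : IsPotentialOn S θ f W) : IsFirstIntegralOn S f W :=
  ⟨hf.1, fun u hu => neg_eq_zero.1 <| (hf.interior_eval hu (S u)).symm.trans <|
    (DForm.eval_interior S θ.extD u (S u)).trans (DForm.two_apply_self _ u (S u))⟩

lemma mono {W' : Set (J1 n π)} (hf : IsPotentialOn S θ f W) (h : W' ⊆ W) : IsPotentialOn S θ f W' :=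
  ⟨hf.1.mono h, fun u hu => hf.2 u (h hu)⟩

lemma contMDiffOn_lagrangianPart (hf : IsPotentialOn S θ f W) (hS : IsSemispray S) (hW : IsOpen W)
    (hθ : θ.IsSmoothOn W) :
    ContMDiffOn 𝓘(ℝ, JetModel n) 𝓘(ℝ, ℝ) ∞ (lagrangianPart S θ f) W :=
  (DForm.contMDiffOn_eval hS.smooth hW hθ).sub hf.1

lemma eq_poincareCartan_add_smulDt (hf : IsPotentialOn S θ f W) (hS : IsSemispray S)
    (hW : IsOpen W) (hθ : θ.IsSmoothOn W) (hsemi : IsSemibasicOn θ W) (hu : u ∈ W) :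
    θ u = (poincareCartan (lagrangianPart S θ f) + smulDt f) u :=
  DForm.ext_one fun v => by
    have hdL : (DForm.differential (lagrangianPart S θ f)).eval u (verticalEndo n π u v) =
        (DForm.differential fun w => θ.eval w (S w)).eval u (verticalEndo n π u v) -
          (DForm.differential f).eval u (verticalEndo n π u v) :=
      DForm.eval_congr (θ' := (DForm.differential fun w => θ.eval w (S w)) - DForm.differential f)
        (DForm.differential_sub hW (DForm.contMDiffOn_eval hS.smooth hW hθ) hf.1 hu) _
    have hθL := poincareCartan_eval (lagrangianPart S θ f) u v
    rw [hdL] at hθL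
    rw [hsemi.eval_eq hθ hW hS hu, hf.interior_eval hu]
    change _ = (poincareCartan (lagrangianPart S θ f)).eval u v + f u * (dtForm n π).eval u v
    rw [hθL]
    change _ = (θ.eval u (S u) - f u) * _ + _ + _
    ring

lemma extD_add_interior_wedge (hf : IsPotentialOn S θ f W) (hW : IsOpen W)
    (hL : ContMDiffOn 𝓘(ℝ, JetModel n) 𝓘(ℝ, ℝ) ∞ L W)
    (hθ : ∀ u ∈ W, θ u = (poincareCartan L + smulDt f) u) (hu : u ∈ W) :
    (θ.extD + (DForm.interior S θ.extD).wedge (dtForm n π)) u = (poincareCartan L).extD u := by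
  have hd : θ.extD u = (poincareCartan L).extD u + (DForm.differential f).wedge (dtForm n π) u := by
    rw [DForm.extD_congr hW hθ hu, DForm.extD_add hW (isSmoothOn_poincareCartan hW hL)
      (isSmoothOn_smulDt hf.1) hu, extD_smulDt hW hf.1 hu]
  have hwedge : (DForm.interior S θ.extD).wedge (dtForm n π) u =
      -(DForm.differential f).wedge (dtForm n π) u := alternating_two_ext fun v w => by
    refine (DForm.wedge_apply _ _ u v w).trans ?_
    rw [hf.interior_eval hu, hf.interior_eval hu, neg_mul, neg_mul, ← neg_sub',
      ← DForm.wedge_apply]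
    rfl
  rw [Pi.add_apply, hd, hwedge, add_neg_cancel_right]

lemma isLagrangianFor_lagrangianPart (hf : IsPotentialOn S θ f W) (hS : IsSemispray S)
    (hW : IsOpen W) (hθ : θ ∈ LambdaS S W) : IsLagrangianFor S (lagrangianPart S θ f) W := by
  obtain ⟨hsmooth, hsemi, hrank, -⟩ := hθ
  have hL := hf.contMDiffOn_lagrangianPart hS hW hsmooth
  have hd : ∀ u ∈ W, (θ.extD + (DForm.interior S θ.extD).wedge (dtForm n π)) u =
      (poincareCartan (lagrangianPart S θ f)).extD u := fun u hu =>
    hf.extD_add_interior_wedge hW hL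
      (fun v hv => hf.eq_poincareCartan_add_smulDt hS hW hsmooth hsemi hv) hu
  refine (isLagrangianFor_iff hS).2 ⟨⟨hL, fun u hu => ?_⟩, fun u hu => ?_⟩
  · rw [← DForm.rankAt_congr (hd u hu), hrank u hu]
  · rw [← DForm.interior_congr (hd u hu)]
    exact hS.interior_add_wedge_dtForm _ u

lemma mem_lambdaS (hf : IsPotentialOn S (poincareCartan L + smulDt f) f W) (hW : IsOpen W)
    (hL : IsRegularLagrangianOn L W) : poincareCartan L + smulDt f ∈ LambdaS S W := by
  have hsmooth := (isSmoothOn_poincareCartan hW hL.1).add (isSmoothOn_smulDt hf.1)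
  refine ⟨hsmooth, fun u hu v hv => ?_, fun u hu => ?_, fun u hu => ?_⟩
  · exact (congrArg₂ (· + ·) (isSemibasicOn_poincareCartan L W u hu v hv)
      (isSemibasicOn_smulDt f W u hu v hv)).trans (add_zero 0)
  · rw [DForm.rankAt_congr (hf.extD_add_interior_wedge hW hL.1 (fun _ _ => rfl) hu), hL.2 u hu]
  · rw [DForm.lie_extD S hW hsmooth hu, DForm.extD_congr hW hf.2 hu, ← DForm.differential_neg]
    exact DForm.extD_differential hW hf.1.neg hu

end IsPotentialOn

lemma lambdaS_mono {W' : Set (J1 n π)} (h : W' ⊆ W) (hθ : θ ∈ LambdaS S W) : θ ∈ LambdaS S W' :=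
  ⟨hθ.1.mono h, fun u hu => hθ.2.1 u (h hu), fun u hu => hθ.2.2.1 u (h hu),
    fun u hu => hθ.2.2.2 u (h hu)⟩

lemma isFirstIntegralOn_zero : IsFirstIntegralOn S 0 W :=
  ⟨contMDiffOn_const, fun _ _ => by rw [DForm.differential_zero]; rfl⟩

lemma IsLagrangianFor.isPotentialOn (hL : IsLagrangianFor S L W) (hS : IsSemispray S)
    (hW : IsOpen W) (hf : IsFirstIntegralOn S f W) :
    IsPotentialOn S (poincareCartan L + smulDt f) f W := by
  refine ⟨hf.1, fun u hu => DForm.ext_one fun v => ?_⟩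
  have hd : (poincareCartan L + smulDt f).extD u =
      ((poincareCartan L).extD + (DForm.differential f).wedge (dtForm n π)) u := by
    rw [DForm.extD_add hW (isSmoothOn_poincareCartan hW hL.1.1) (isSmoothOn_smulDt hf.1) hu,
      extD_smulDt hW hf.1 hu, Pi.add_apply]
  have hθL : (poincareCartan L).extD u ![S u, v] = 0 :=
    (DForm.eval_interior S _ u v).symm.trans
      (DForm.eval_congr (θ' := 0) (((isLagrangianFor_iff hS).1 hL).2 u hu) v)
  have hwedge := DForm.wedge_apply (DForm.differential f) (dtForm n π) u (S u) v
  rw [hf.2 u hu, hS.time, zero_mul, mul_one, zero_sub] at hwedge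
  rw [DForm.eval_interior, hd]
  exact (congrArg₂ (· + ·) hθL hwedge).trans (zero_add _)

lemma isPotentialOn_zero_iff : IsPotentialOn S θ 0 W ↔ ∀ u ∈ W, DForm.interior S θ.extD u = 0 := by
  rw [IsPotentialOn, DForm.differential_zero, neg_zero]
  exact and_iff_right contMDiffOn_const

lemma isSmoothOn_interior_extD (hS : IsSemispray S) (hW : IsOpen W) (hθ : θ ∈ LambdaS S W) :
    (DForm.interior S θ.extD).IsSmoothOn W :=
  (hθ.1.extD hW).interior hS.smooth

lemma extD_interior_extD (hW : IsOpen W) (hθ : θ ∈ LambdaS S W) (hu : u ∈ W) :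
    (DForm.interior S θ.extD).extD u = (0 : DForm (JetModel n) (J1 n π) 2) u :=
  (DForm.lie_extD S hW hθ.1 hu).symm.trans (hθ.2.2.2 u hu)

/-- If `d_J θ = 0`, then `i_S dθ` is closed, semi-basic and annihilates `S`, hence vanishes. -/
lemma isPotentialOn_zero_of_dJ_eq_zero (hS : IsSemispray S) (hW : IsOpen W) (hθ : θ ∈ LambdaS S W)
    (hJ : ∀ u ∈ W, dJ θ u = 0) : IsPotentialOn S θ 0 W := by
  set α := DForm.interior S θ.extD
  have hα : α.IsSmoothOn W := isSmoothOn_interior_extD hS hW hθ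
  have hαS : (fun u => α.eval u (S u)) = 0 := funext fun u =>
    (DForm.eval_interior S θ.extD u (S u)).trans (DForm.two_apply_self _ u (S u))
  have hαsemi : IsSemibasicOn α W := isSemibasicOn_iff.2 fun u hu v => by
    have h := hθ.2.1.dJ_apply hW hu (S u) v
    rw [hJ u hu, hS.vertical, DForm.two_apply_zero_left, zero_add] at h
    exact (DForm.eval_interior S θ.extD u _).trans h.symm
  refine isPotentialOn_zero_iff.2 fun u hu => DForm.ext_one (θ' := 0) fun v => ?_
  have hdα : (DForm.interior S α.extD).eval u (verticalEndo n π u v) = 0 :=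
    DForm.eval_congr (θ' := 0) (DForm.interior_congr (extD_interior_extD hW hθ hu)) _
  rw [hαsemi.eval_eq hα hW hS hu, hαS, DForm.differential_zero, congrFun hαS u, hdα]
  exact (congrArg (· + _) (zero_mul _)).trans ((zero_add _).trans (zero_add _))

namespace IsPotentialOn

lemma eq_poincareCartan (h₀ : IsPotentialOn S θ 0 W) (hS : IsSemispray S) (hW : IsOpen W)
    (hθ : θ ∈ LambdaS S W) (hu : u ∈ W) : θ u = poincareCartan (lagrangianPart S θ 0) u := by
  have hdt : (smulDt 0 : DForm (JetModel n) (J1 n π) 1) = 0 := funext fun u => zero_smul ℝ _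
  rw [h₀.eq_poincareCartan_add_smulDt hS hW hθ.1 hθ.2.1 hu, hdt, add_zero]

lemma dJ_eq_zero_iff (hf : IsPotentialOn S θ f W) (hS : IsSemispray S) (hW : IsOpen W)
    (hθ : θ ∈ LambdaS S W) :
    (∀ u ∈ W, dJ θ u = 0) ↔
      ∀ u ∈ W, (DForm.differential f : DForm (JetModel n) (J1 n π) 1) u = 0 := by
  have hpot : (∀ u ∈ W, (DForm.differential f : DForm (JetModel n) (J1 n π) 1) u = 0) ↔
      IsPotentialOn S θ 0 W := by
    refine (forall₂_congr fun u hu => ?_).trans isPotentialOn_zero_iff.symm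
    rw [hf.2 u hu]
    exact neg_eq_zero.symm
  refine Iff.trans ⟨isPotentialOn_zero_of_dJ_eq_zero hS hW hθ, fun h₀ u hu => ?_⟩ hpot.symm
  exact (DForm.dEndo_congr _ hW (fun _ hv => h₀.eq_poincareCartan hS hW hθ hv) hu).trans
    (dJ_poincareCartan hW (h₀.contMDiffOn_lagrangianPart hS hW hθ.1) hu)

lemma exists_dJ_ne_zero_iff (hf : IsPotentialOn S θ f W) (hS : IsSemispray S) (hW : IsOpen W)
    (hθ : θ ∈ LambdaS S W) :
    (∃ u ∈ W, dJ θ u ≠ 0) ↔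
      ∃ u ∈ W, (DForm.differential f : DForm (JetModel n) (J1 n π) 1) u ≠ 0 := by
  simpa only [not_forall, exists_prop] using not_congr (hf.dJ_eq_zero_iff hS hW hθ)

lemma frequently_dJ_ne_zero_iff (hf : IsPotentialOn S θ f W) (hS : IsSemispray S) (hW : IsOpen W)
    (hθ : θ ∈ LambdaS S W) (hu : u ∈ W) :
    (∃ᶠ v in 𝓝 u, dJ θ v ≠ 0) ↔
      ∃ᶠ v in 𝓝 u, (DForm.differential f : DForm (JetModel n) (J1 n π) 1) v ≠ 0 := by
  have hbasis := (nhds_basis_opens u).restrict_subset (hW.mem_nhds hu)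
  rw [hbasis.frequently_iff, hbasis.frequently_iff]
  exact forall₂_congr fun W' ⟨⟨_, hW'⟩, hsub⟩ =>
    (hf.mono hsub).exists_dJ_ne_zero_iff hS hW' (lambdaS_mono hsub hθ)

lemma hasLagrangianDecompositionOn (hf : IsPotentialOn S θ f W) (hS : IsSemispray S)
    (hW : IsOpen W) (hθ : θ ∈ LambdaS S W) : HasLagrangianDecompositionOn S θ W :=
  ⟨lagrangianPart S θ f, f, hf.isLagrangianFor_lagrangianPart hS hW hθ, hf.isFirstIntegralOn,
    fun _ hu => hf.eq_poincareCartan_add_smulDt hS hW hθ.1 hθ.2.1 hu,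
    (hf.exists_dJ_ne_zero_iff hS hW hθ).1⟩

end IsPotentialOn

lemma isPotentialOn_neg {g : J1 n π → ℝ} (hg : ContMDiffOn 𝓘(ℝ, JetModel n) 𝓘(ℝ, ℝ) ∞ g W)
    (hθ : ∀ u ∈ W, DForm.interior S θ.extD u = DForm.differential g u) :
    IsPotentialOn S θ (-g) W := by
  refine ⟨hg.neg, fun u hu => ?_⟩
  rw [hθ u hu, DForm.differential_neg, neg_neg]

lemma exists_local_isPotentialOn (hS : IsSemispray S) (hW : IsOpen W) (hθ : θ ∈ LambdaS S W)
    (hu : u ∈ W) : ∃ W', IsOpen W' ∧ u ∈ W' ∧ W' ⊆ W ∧ ∃ f, IsPotentialOn S θ f W' := by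
  obtain ⟨W', hW', huW', hsub, g, hg, hθg⟩ := DForm.exists_local_primitive hW
    (isSmoothOn_interior_extD hS hW hθ) (fun _ hv => extD_interior_extD hW hθ hv) hu
  exact ⟨W', hW', huW', hsub, -g, isPotentialOn_neg hg hθg⟩

lemma ClosedOneFormsExactOn.exists_isPotentialOn (hexact : ClosedOneFormsExactOn (JetModel n) W)
    (hS : IsSemispray S) (hW : IsOpen W) (hθ : θ ∈ LambdaS S W) : ∃ f, IsPotentialOn S θ f W := by
  obtain ⟨g, hg, hθg⟩ := hexact _ (isSmoothOn_interior_extD hS hW hθ)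
    fun _ hv => extD_interior_extD hW hθ hv
  exact ⟨-g, isPotentialOn_neg hg hθg⟩

theorem isLagrangianOn_iff (hS : IsSemispray S) (hW : IsOpen W) :
    IsLagrangianOn S W ↔ ∃ θ ∈ LambdaS S W, ∀ v ∈ W, dJ θ v = 0 := by
  constructor
  · rintro ⟨L, hL⟩
    have hzero : IsPotentialOn S (poincareCartan L + smulDt 0) 0 W :=
      hL.isPotentialOn hS hW isFirstIntegralOn_zero
    have hmem := hzero.mem_lambdaS hW hL.1
    exact ⟨_, hmem, (hzero.dJ_eq_zero_iff hS hW hmem).2 fun u _ =>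
      congrFun DForm.differential_zero u⟩
  · rintro ⟨θ, hθ, hJ⟩
    exact ⟨_, (isPotentialOn_zero_of_dJ_eq_zero hS hW hθ hJ).isLagrangianFor_lagrangianPart
      hS hW hθ⟩

theorem exists_eq_poincareCartan (hS : IsSemispray S) (hW : IsOpen W) (hθ : θ ∈ LambdaS S W)
    (hJ : ∀ v ∈ W, dJ θ v = 0) :
    ∃ L, IsRegularLagrangianOn L W ∧ (∀ v ∈ W, θ v = poincareCartan L v) ∧
      ∀ v ∈ W, DForm.lie S θ v = DForm.differential L v := by
  have h₀ := isPotentialOn_zero_of_dJ_eq_zero hS hW hθ hJ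
  have hL := h₀.isLagrangianFor_lagrangianPart hS hW hθ
  have hθL : ∀ v ∈ W, θ v = poincareCartan (lagrangianPart S θ 0) v := fun _ hv =>
    h₀.eq_poincareCartan hS hW hθ hv
  exact ⟨_, hL.1, hθL, fun v hv => (DForm.lie_congr S hW hθL hv).trans (hL.2 v hv)⟩

theorem isConservativeLagrangian_iff (hS : IsSemispray S) :
    IsConservativeLagrangian S ↔
      ∀ u, ∃ W, IsOpen W ∧ u ∈ W ∧ ∃ θ ∈ LambdaS S W, ∃ᶠ v in 𝓝 u, dJ θ v ≠ 0 := by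
  refine forall_congr' fun u => ⟨?_, ?_⟩
  · rintro ⟨W, hW, hu, L, f, hL, hf, hdf⟩
    have hpot := hL.isPotentialOn hS hW hf
    have hmem := hpot.mem_lambdaS hW hL.1
    exact ⟨W, hW, hu, _, hmem, (hpot.frequently_dJ_ne_zero_iff hS hW hmem hu).2 hdf⟩
  · rintro ⟨W, hW, hu, θ, hθ, hJ⟩
    obtain ⟨W', hW', hu', hsub, f, hf⟩ := exists_local_isPotentialOn hS hW hθ hu
    have hθ' := lambdaS_mono hsub hθ
    exact ⟨W', hW', hu', lagrangianPart S θ f, f, hf.isLagrangianFor_lagrangianPart hS hW' hθ',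
      hf.isFirstIntegralOn, (hf.frequently_dJ_ne_zero_iff hS hW' hθ' hu').1 hJ⟩

theorem IsConservativeLagrangianOn.exists_dJ_ne_zero (h : IsConservativeLagrangianOn S W)
    (hS : IsSemispray S) (hW : IsOpen W) : ∃ θ ∈ LambdaS S W, ∃ v ∈ W, dJ θ v ≠ 0 := by
  obtain ⟨L, f, hL, hf, hdf⟩ := h
  have hpot := hL.isPotentialOn hS hW hf
  have hmem := hpot.mem_lambdaS hW hL.1
  exact ⟨_, hmem, (hpot.exists_dJ_ne_zero_iff hS hW hmem).2 hdf⟩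

lemma HasLagrangianDecompositionOn.isConservativeLagrangianOn
    (h : HasLagrangianDecompositionOn S θ W) (hJ : ∃ v ∈ W, dJ θ v ≠ 0) :
    IsConservativeLagrangianOn S W := by
  obtain ⟨L, f, hL, hf, -, hdf⟩ := h
  exact ⟨L, f, hL, hf, hdf hJ⟩

theorem exists_local_hasLagrangianDecompositionOn (hS : IsSemispray S) (hW : IsOpen W)
    (hθ : θ ∈ LambdaS S W) (hu : u ∈ W) :
    ∃ W', IsOpen W' ∧ u ∈ W' ∧ W' ⊆ W ∧ HasLagrangianDecompositionOn S θ W' := by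
  obtain ⟨W', hW', hu', hsub, f, hf⟩ := exists_local_isPotentialOn hS hW hθ hu
  exact ⟨W', hW', hu', hsub, hf.hasLagrangianDecompositionOn hS hW' (lambdaS_mono hsub hθ)⟩

theorem ClosedOneFormsExactOn.hasLagrangianDecompositionOn
    (hexact : ClosedOneFormsExactOn (JetModel n) W) (hS : IsSemispray S) (hW : IsOpen W)
    (hθ : θ ∈ LambdaS S W) : HasLagrangianDecompositionOn S θ W := by
  obtain ⟨f, hf⟩ := hexact.exists_isPotentialOn hS hW hθ
  exact hf.hasLagrangianDecompositionOn hS hW hθ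

end JetForms

theorem proposition4p6 {n : ℕ} {M : Type*} [TopologicalSpace M]
    [ChartedSpace (EuclideanSpace ℝ (Fin (n + 1))) M] [IsManifold (𝓡 (n + 1)) ∞ M]
    (π : M → ℝ) [IsFibredOverReal n π]
    (S : VField (JetModel n) (J1 n π)) (hS : IsSemispray S) :
    -- (i), around every point
    (IsLagrangian S ↔
      ∀ u : J1 n π, ∃ W : Set (J1 n π), IsOpen W ∧ u ∈ W ∧
        ∃ θ ∈ LambdaS S W, ∀ v ∈ W, dJ θ v = 0) ∧
    -- (i), on any given open set, in particular on the whole jet bundle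
    (∀ W : Set (J1 n π), IsOpen W →
      (IsLagrangianOn S W ↔ ∃ θ ∈ LambdaS S W, ∀ v ∈ W, dJ θ v = 0)) ∧
    (∀ W : Set (J1 n π), IsOpen W → ∀ θ ∈ LambdaS S W, (∀ v ∈ W, dJ θ v = 0) →
      ∃ L : J1 n π → ℝ, IsRegularLagrangianOn L W ∧
        (∀ v ∈ W, θ v = poincareCartan L v) ∧
        (∀ v ∈ W, DForm.lie S θ v = DForm.differential L v)) ∧
    -- (ii), around every point
    (IsConservativeLagrangian S ↔
      ∀ u : J1 n π, ∃ W : Set (J1 n π), IsOpen W ∧ u ∈ W ∧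
        ∃ θ ∈ LambdaS S W, ∃ᶠ v in 𝓝 u, dJ θ v ≠ 0) ∧
    -- (ii), on any given open set
    (∀ W : Set (J1 n π), IsOpen W → IsConservativeLagrangianOn S W →
      ∃ θ ∈ LambdaS S W, ∃ v ∈ W, dJ θ v ≠ 0) ∧
    (∀ W : Set (J1 n π), IsOpen W → ClosedOneFormsExactOn (JetModel n) W →
      (IsConservativeLagrangianOn S W ↔ ∃ θ ∈ LambdaS S W, ∃ v ∈ W, dJ θ v ≠ 0)) ∧
    (∀ W : Set (J1 n π), IsOpen W → ∀ θ ∈ LambdaS S W, (∃ v ∈ W, dJ θ v ≠ 0) →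
      (∀ u ∈ W, ∃ W' : Set (J1 n π), IsOpen W' ∧ u ∈ W' ∧ W' ⊆ W ∧
        HasLagrangianDecompositionOn S θ W') ∧
      (ClosedOneFormsExactOn (JetModel n) W → HasLagrangianDecompositionOn S θ W)) := by
  refine ⟨forall_congr' fun u => exists_congr fun W => and_congr_right fun hW =>
      and_congr_right fun _ => isLagrangianOn_iff hS hW,
    fun W hW => isLagrangianOn_iff hS hW,
    fun W hW θ hθ hJ => exists_eq_poincareCartan hS hW hθ hJ,
    isConservativeLagrangian_iff hS,
    fun W hW h => h.exists_dJ_ne_zero hS hW,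
    fun W hW hexact => ⟨fun h => h.exists_dJ_ne_zero hS hW, fun ⟨θ, hθ, hJ⟩ =>
      (hexact.hasLagrangianDecompositionOn hS hW hθ).isConservativeLagrangianOn hJ⟩,
    fun W hW θ hθ _ => ⟨fun u hu => exists_local_hasLagrangianDecompositionOn hS hW hθ hu,
      fun hexact => hexact.hasLagrangianDecompositionOn hS hW hθ⟩⟩
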